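/- Let $\mathfrak H$ be a complex Hilbert space, let $B_1,B_2$ be densely defined closed operators in $\mathfrak H$, and let $S=B_1\cap B_2$ be their intersection, that is, $Sf=B_1f=B_2f$ on $\operatorname{dom}(S)=\{f\in\operatorname{dom}(B_1)\cap\operatorname{dom}(B_2): B_1f=B_2f\}$. Assume that $S$ is densely defined and symmetric, and let $A_0$ be a self-adjoint extension of $S$ such that $$S=A_0\cap B_1=A_0\cap B_2=A_0\cap B_1^*=A_0\cap B_2^*.$$ Let $\{\mathcal G,\Gamma_0,\Gamma_1\}$ be a boundary triple for $S^*$, that is, $\mathcal G$ is a complex Hilbert space and $\Gamma_0,\Gamma_1:\operatorname{dom}(S^*)\to\mathcal G$ are linear maps such that $f\mapsto(\Gamma_0f,\Gamma_1f)$ is onto $\mathcal G\times\mathcal G$ and, with scalar products linear in the first entry, $$(S^*f,g)_{\mathfrak H}-(f,S^*g)_{\mathfrak H}=(\Gamma_1f,\Gamma_0g)_{\mathcal G}-(\Gamma_0f,\Gamma_1g)_{\mathcal G},\qquad f,g\in\operatorname{dom}(S^*).$$ Assume that $A_0=S^*\upharpoonright\ker(\Gamma_0)$, and let $\Theta_1,\Theta_2$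 be densely defined closed operators in $\mathcal G$ with $$B_j=S^*\upharpoonright\ker(\Gamma_1-\Theta_j\Gamma_0)=S^*\upharpoonright\{f\in\operatorname{dom}(S^*):\Gamma_0f\in\operatorname{dom}(\Theta_j),\ \Gamma_1f=\Theta_j\Gamma_0f\},\qquad j=1,2.$$ Let $M(z)=\Gamma_1\bigl(\Gamma_0\upharpoonright\ker(S^*-z)\bigr)^{-1}$, $z\in\rho(A_0)$, be the corresponding Weyl--Titchmarsh function. For a closed operator $T$ let $m_a(z;T)$ be the dimension of the algebraic eigenspace $\bigcup_{n}\ker((T-z)^n)$ (so $m_a(z;T)=0$ for $z\in\rho(T)$), and let the discrete spectrum $\sigma_d(T)$ be the set of eigenvalues of $T$ that are isolated in $\sigma(T)$ and of finite algebraic multiplicity, in the sense that the Riesz projection $-\frac1{2\pi i}\oint_{C(z;\varepsilon)}(T-\zeta)^{-1}d\zeta$, $\varepsilon>0$ small, has finite rank. Here $D(z;\varepsilon)$ is the open disc and $C(z;\varepsilon)$ its counterclockwise oriented boundary circle. A $\mathcal B(\mathcal G)$-valued function is called finitely meromorphic at a point if near this point it is the sum of an analytic function and a finite principal part whose coefficients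 have finite rank, and finitely meromorphic on an open set if this holds at every point of the set. For $\Omega\subseteq\mathbb C$ open and connected and $\mathcal D_0\subset\Omega$ without limit points in $\Omega$, a function $N(\cdot)$ on $\Omega\setminus\mathcal D_0$ whose values are densely defined closed operators in $\mathcal G$ satisfies the index hypothesis on $(\Omega,\mathcal D_0)$ if 1. $\operatorname{dom}(N(z))=:\mathcal N_0$ does not depend on $z\in\Omega\setminus\mathcal D_0$; 2. $N(z)^{-1}\in\mathcal B(\mathcal G)$ for all $z\in\Omega\setminus\mathcal D_0$; 3. $N(\cdot)^{-1}$ is analytic on $\Omega\setminus\mathcal D_0$ and finitely meromorphic on $\Omega$; 4. $N(\cdot)\varphi$ is analytic on $\Omega\setminus\mathcal D_0$ for every $\varphi\in\mathcal N_0$; 5. for $z\in\Omega\setminus\mathcal D_0$ the operator $N'(z)$, defined on $\mathcal N_0$ by $N'(z)\varphi=\frac{d}{dz}N(z)\varphi$, extends to an operator $\overline{N'(z)}\in\mathcal B(\mathcal G)$, and $\overline{N'(\cdot)}$ is analytic on $\Omega\setminus\mathcal D_0$ and finitely meromorphic on $\Omega$. In this case, for $z_0\in\Omega$ and small $\varepsilon>0$,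 the generalized index is $$\widetilde{\operatorname{ind}}_{C(z_0;\varepsilon)}(N(\cdot))=\operatorname{tr}_{\mathcal G}\Bigl(\frac1{2\pi i}\oint_{C(z_0;\varepsilon)}\overline{N'(\zeta)}\,N(\zeta)^{-1}\,d\zeta\Bigr).$$ **Theorem.** Assume that $z_0\in\sigma_d(B_j)\cup\rho(B_j)$ for $j=1,2$ and $z_0\in\sigma_d(A_0)\cup\rho(A_0)$. Then there exists $\varepsilon_0>0$ such that both functions $\Theta_j-M(\cdot)$, $j=1,2$, satisfy the index hypothesis on $(D(z_0;\varepsilon_0),\{z_0\})$, and for all $0<\varepsilon<\varepsilon_0$ the operators whose traces define the two generalized indices have finite rank and $$\widetilde{\operatorname{ind}}_{C(z_0;\varepsilon)}(\Theta_1-M(\cdot))-\widetilde{\operatorname{ind}}_{C(z_0;\varepsilon)}(\Theta_2-M(\cdot))=m_a(z_0;B_1)-m_a(z_0;B_2).$$ -/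

import Mathlib

namespace ExtIndex

noncomputable section

section Operators

variable {H : Type*} [NormedAddCommGroup H] [InnerProductSpace ℂ H]

/-- The difference `T - K` of an unbounded operator `T` and an everywhere defined linear map `K`,
with domain `dom (T - K) = dom T`. -/
def subMap (T : H →ₗ.[ℂ] H) (K : H →ₗ[ℂ] H) : H →ₗ.[ℂ] H where
  domain := T.domain
  toFun := T.toFun - K ∘ₗ T.domain.subtype

/-- The operator `T - z I`, with domain `dom T`. -/
def shift (T : H →ₗ.[ℂ] H) (z : ℂ) : H →ₗ.[ℂ] H :=
  subMap T (z • LinearMap.id)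

/-- `R` is an everywhere defined bounded two-sided inverse of the unbounded operator `T`. -/
def IsBoundedInverse (T : H →ₗ.[ℂ] H) (R : H →L[ℂ] H) : Prop :=
  (∀ y : H, ∃ h : R y ∈ T.domain, T ⟨R y, h⟩ = y) ∧ ∀ x : T.domain, R (T x) = x

/-- `T` is boundedly invertible. -/
def BoundedlyInvertible (T : H →ₗ.[ℂ] H) : Prop :=
  ∃ R : H →L[ℂ] H, IsBoundedInverse T R

open Classical in
/-- The (unique) bounded inverse `T⁻¹` of a boundedly invertible operator; `0` otherwise. -/
def boundedInverse (T : H →ₗ.[ℂ] H) : H →L[ℂ] H :=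
  if h : BoundedlyInvertible T then h.choose else 0

/-- The resolvent set `ρ(T)`. -/
def resSet (T : H →ₗ.[ℂ] H) : Set ℂ :=
  {z | BoundedlyInvertible (shift T z)}

/-- The resolvent `(T - z I)⁻¹`. -/
def resolventOp (T : H →ₗ.[ℂ] H) (z : ℂ) : H →L[ℂ] H :=
  boundedInverse (shift T z)

/-- Bounded operators with finite-dimensional range. -/
def FiniteRank (K : H →L[ℂ] H) : Prop :=
  FiniteDimensional ℂ (LinearMap.range (K : H →ₗ[ℂ] H))

/-- The trace of a finite rank operator `K`: the trace of `K` on its finite-dimensional invariant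
subspace `ran K`. -/
def finiteRankTrace (K : H →L[ℂ] H) : ℂ :=
  LinearMap.trace ℂ (LinearMap.range (K : H →ₗ[ℂ] H))
    ((K : H →ₗ[ℂ] H).rangeRestrict ∘ₗ (LinearMap.range (K : H →ₗ[ℂ] H)).subtype)

/-- The Riesz projection `-(2πi)⁻¹ ∮_{C(z₀;ε)} (T - ζ I)⁻¹ dζ`. -/
def rieszProjection (T : H →ₗ.[ℂ] H) (z₀ : ℂ) (ε : ℝ) : H →L[ℂ] H :=
  -((2 * Real.pi * Complex.I : ℂ)⁻¹ • ∮ ζ in C(z₀, ε), resolventOp T ζ)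

/-- The kernels `ker (T - z I)^n`, where the powers carry their natural domains. -/
def kerPow (T : H →ₗ.[ℂ] H) (z : ℂ) : ℕ → Submodule ℂ H
  | 0 => ⊥
  | n + 1 => ((kerPow T z n).comap (shift T z).toFun).map T.domain.subtype

/-- The algebraic eigenspace `⋃ n, ker (T - z I)^n` of `T` at `z`. -/
def algEigenspace (T : H →ₗ.[ℂ] H) (z : ℂ) : Submodule ℂ H :=
  ⨆ n, kerPow T z n

/-- The algebraic multiplicity `m_a(z;T)`, the dimension of the algebraic eigenspace.
It is `0` for `z ∈ ρ(T)`. -/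
def algMult (T : H →ₗ.[ℂ] H) (z : ℂ) : ℕ :=
  Module.finrank ℂ (algEigenspace T z)

/-- The discrete spectrum `σ_d(T)`: eigenvalues that are isolated in the spectrum and have finite
algebraic multiplicity. As usual for isolated points of the spectrum of a closed
operator, finite algebraic multiplicity means that the Riesz projection, taken over any circle
that separates the point from the rest of the spectrum, has finite rank; its range is then the
algebraic eigenspace. -/
def discreteSpectrum (T : H →ₗ.[ℂ] H) : Set ℂ :=
  {z₀ | (∃ x : T.domain, (x : H) ≠ 0 ∧ T x = z₀ • (x : H)) ∧
    ∃ ε₀ > 0, Metric.ball z₀ ε₀ \ {z₀} ⊆ resSet T ∧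
      ∀ ε, 0 < ε → ε < ε₀ → FiniteRank (rieszProjection T z₀ ε)}

end Operators

section Meromorphic

variable {G : Type*} [NormedAddCommGroup G] [InnerProductSpace ℂ G]

/-- `F` is finitely meromorphic at `z₀`: on a punctured disc around `z₀` it is the sum of a
finite principal part `∑_{k=1}^{N} (z - z₀)^{-k} A_k` with finite rank coefficients and of a
function that is analytic at `z₀`. -/
def FinitelyMeromorphicAt (F : ℂ → G →L[ℂ] G) (z₀ : ℂ) : Prop :=
  ∃ (N : ℕ) (A : ℕ → G →L[ℂ] G) (g : ℂ → G →L[ℂ] G),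
    (∀ k, FiniteRank (A k)) ∧ AnalyticAt ℂ g z₀ ∧
    ∀ᶠ z in nhdsWithin z₀ {z₀}ᶜ,
      F z = (∑ k ∈ Finset.Icc 1 N, ((z - z₀) ^ k)⁻¹ • A k) + g z

/-- `F` is finitely meromorphic on `Ω`. (At a point that is not a pole the condition is
meromorphy with empty principal part.) -/
def FinitelyMeromorphicOn (F : ℂ → G →L[ℂ] G) (Ω : Set ℂ) : Prop :=
  ∀ z ∈ Ω, FinitelyMeromorphicAt F z

open Classical in
/-- The value `T φ` for `φ ∈ dom T`, extended by `0` to all of `G`. -/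
def value (T : G →ₗ.[ℂ] G) (φ : G) : G :=
  if h : φ ∈ T.domain then T ⟨φ, h⟩ else 0

/-- `K` is a bounded continuation of the operator `M'(z)`, which is defined on `dom M(z)` by
`M'(z) φ = d/dz (M(z) φ)`. -/
def IsDerivExtension (M : ℂ → G →ₗ.[ℂ] G) (z : ℂ) (K : G →L[ℂ] G) : Prop :=
  ∀ φ ∈ (M z).domain, K φ = deriv (fun w => value (M w) φ) z

open Classical in
/-- The bounded continuation of `M'(z)` to all of `G` (unique if `dom M(z)` is dense);
`0` if there is none. -/
def derivClosure (M : ℂ → G →ₗ.[ℂ] G) (z : ℂ) : G →L[ℂ] G :=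
  if h : ∃ K : G →L[ℂ] G, IsDerivExtension M z K then h.choose else 0

/-- The hypothesis under which the generalized index of a family `M(·)` of densely defined closed
operators on `Ω \ D₀` is defined. -/
structure IndexHypothesis (M : ℂ → G →ₗ.[ℂ] G) (Ω D₀ : Set ℂ) : Prop where
  isOpen : IsOpen Ω
  isConnected : IsConnected Ω
  subset : D₀ ⊆ Ω
  /-- `D₀` has no limit points in `Ω` -/
  discrete : ∀ z ∈ Ω, ¬ AccPt z (Filter.principal D₀)
  dense : ∀ z ∈ Ω \ D₀, Dense ((M z).domain : Set G)
  closed : ∀ z ∈ Ω \ D₀, (M z).IsClosed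
  /-- (i) the domain is independent of `z` -/
  domain_eq : ∀ z ∈ Ω \ D₀, ∀ w ∈ Ω \ D₀, (M z).domain = (M w).domain
  /-- (ii) -/
  invertible : ∀ z ∈ Ω \ D₀, BoundedlyInvertible (M z)
  /-- (iii) -/
  inverse_analytic : AnalyticOnNhd ℂ (fun z => boundedInverse (M z)) (Ω \ D₀)
  inverse_finMero : FinitelyMeromorphicOn (fun z => boundedInverse (M z)) Ω
  /-- (iv) -/
  strongly_analytic : ∀ φ : G, (∀ z ∈ Ω \ D₀, φ ∈ (M z).domain) →
    AnalyticOnNhd ℂ (fun z => value (M z) φ) (Ω \ D₀)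
  /-- (v) -/
  deriv_bounded : ∀ z ∈ Ω \ D₀, ∃ K : G →L[ℂ] G, IsDerivExtension M z K
  deriv_analytic : AnalyticOnNhd ℂ (derivClosure M) (Ω \ D₀)
  deriv_finMero : FinitelyMeromorphicOn (derivClosure M) Ω

/-- The operator `(2πi)⁻¹ ∮_{C(z₀;ε)} closure(M'(ζ)) M(ζ)⁻¹ dζ`. -/
def indexOperator (M : ℂ → G →ₗ.[ℂ] G) (z₀ : ℂ) (ε : ℝ) : G →L[ℂ] G :=
  (2 * Real.pi * Complex.I : ℂ)⁻¹ •
    ∮ ζ in C(z₀, ε), derivClosure M ζ ∘L boundedInverse (M ζ)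

/-- The generalized index of `M(·)` with respect to the circle `C(z₀;ε)`. -/
def generalizedIndex (M : ℂ → G →ₗ.[ℂ] G) (z₀ : ℂ) (ε : ℝ) : ℂ :=
  finiteRankTrace (indexOperator M z₀ ε)

end Meromorphic

section BoundaryTriples

variable {H : Type*} [NormedAddCommGroup H] [InnerProductSpace ℂ H] [CompleteSpace H]

/-- A boundary triple `{G, Γ₀, Γ₁}` for the adjoint `S*`. Mathlib's inner product is conjugate
linear in its first entry, so `inner ℂ g f` is `(f, g)` in the convention in which scalar products
are linear in the first entry. -/
structure BoundaryTriple (S : H →ₗ.[ℂ] H) (G : Type*) [NormedAddCommGroup G]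
    [InnerProductSpace ℂ G] where
  Γ₀ : S.adjoint.domain →ₗ[ℂ] G
  Γ₁ : S.adjoint.domain →ₗ[ℂ] G
  green : ∀ f g : S.adjoint.domain,
    inner ℂ (g : H) (S.adjoint f) - inner ℂ (S.adjoint g) (f : H) =
      inner ℂ (Γ₀ g) (Γ₁ f) - inner ℂ (Γ₁ g) (Γ₀ f)
  surjective : Function.Surjective (Γ₀.prod Γ₁)

variable {S : H →ₗ.[ℂ] H} {G : Type*} [NormedAddCommGroup G] [InnerProductSpace ℂ G]

namespace BoundaryTriple

/-- The restriction of `S*` to `ker Γ₀`. -/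
def kerExtension (b : BoundaryTriple S G) : H →ₗ.[ℂ] H :=
  S.adjoint.domRestrict ((LinearMap.ker b.Γ₀).map S.adjoint.domain.subtype)

/-- The restriction of `S*` to `ker (Γ₁ - Θ Γ₀)`, that is, to the set of all `f ∈ dom S*` with
`Γ₀ f ∈ dom Θ` and `Γ₁ f = Θ Γ₀ f`. -/
def extension (b : BoundaryTriple S G) (Θ : G →ₗ.[ℂ] G) : H →ₗ.[ℂ] H :=
  S.adjoint.domRestrict ((Θ.graph.comap (b.Γ₀.prod b.Γ₁)).map S.adjoint.domain.subtype)

/-- `ker (S* - z I)` as a subspace of `dom S*`. -/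
def defect (S : H →ₗ.[ℂ] H) (z : ℂ) : Submodule ℂ S.adjoint.domain :=
  LinearMap.ker (shift S.adjoint z).toFun

open Classical in
/-- The inverse `(Γ₀ ↾ ker (S* - z I))⁻¹`, with values in `dom S*`. The restriction is bijective
for `z ∈ ρ(S* ↾ ker Γ₀)`; where it is not bijective the value is `0`. -/
def gammaField (b : BoundaryTriple S G) (z : ℂ) : G →ₗ[ℂ] S.adjoint.domain :=
  if h : Function.Bijective (b.Γ₀.domRestrict (defect S z)) then
    (defect S z).subtype ∘ₗ (LinearEquiv.ofBijective _ h).symm.toLinearMap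
  else 0

/-- The Weyl–Titchmarsh function `M(z) = Γ₁ (Γ₀ ↾ ker (S* - z I))⁻¹`. -/
def weyl (b : BoundaryTriple S G) (z : ℂ) : G →ₗ[ℂ] G :=
  b.Γ₁ ∘ₗ b.gammaField z

end BoundaryTriple

/-- The standing hypothesis on `B₁`, `B₂`, `S` and `A₀`. The infimum of two operators is their
intersection: it is defined where both are defined and agree. -/
structure ExtensionHypothesis (B₁ B₂ S A₀ : H →ₗ.[ℂ] H) : Prop where
  dense₁ : Dense (B₁.domain : Set H)
  dense₂ : Dense (B₂.domain : Set H)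
  closed₁ : B₁.IsClosed
  closed₂ : B₂.IsClosed
  eq_inf : S = B₁ ⊓ B₂
  dense : Dense (S.domain : Set H)
  symmetric : S.IsFormalAdjoint S
  selfAdjoint : IsSelfAdjoint A₀
  disjoint₁ : S = A₀ ⊓ B₁
  disjoint₂ : S = A₀ ⊓ B₂
  disjoint_adjoint₁ : S = A₀ ⊓ B₁.adjoint
  disjoint_adjoint₂ : S = A₀ ⊓ B₂.adjoint

end BoundaryTriples

end

end ExtIndex

open ExtIndex

/-!
With the γ-field `γ(z) = (Γ₀ ↾ ker (S* - z))⁻¹`, one has `M' = γ(z̄)* γ(z)` and Krein's formula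
`(A_Θ - z)⁻¹ - (A₀ - z)⁻¹ = γ(z) (Θ - M(z))⁻¹ γ(z̄)*`, where `A_Θ = S* ↾ ker (Γ₁ - Θ Γ₀)`. The trace
of a contour integral of finitely meromorphic functions is invariant under cyclic permutation, so
the generalized index of `Θ - M` at `z₀` is the trace of the difference of the Riesz projections
of `A_Θ` and `A₀`, that is, `m_a(z₀; A_Θ) - m_a(z₀; A₀)`. The contribution of `A₀` cancels in the
difference of the indices for `Θ₁` and `Θ₂`.
-/

namespace ExtIndex

open Filter Topology Metric

section FiniteRank

variable {X Y : Type*} [NormedAddCommGroup X] [InnerProductSpace ℂ X] [NormedAddCommGroup Y]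
  [InnerProductSpace ℂ Y]

theorem finiteRank_iff {K : X →L[ℂ] X} : FiniteRank K ↔ (K : X →ₗ[ℂ] X).HasFiniteRange :=
  Module.Finite.iff_fg

theorem finiteRank_zero : FiniteRank (0 : X →L[ℂ] X) :=
  finiteRank_iff.mpr .zero

theorem finiteRankTrace_eq {K : X →L[ℂ] X} {W : Submodule ℂ X} [FiniteDimensional ℂ W]
    (h : ∀ x, K x ∈ W) :
    finiteRankTrace K =
      LinearMap.trace ℂ W (((K : X →ₗ[ℂ] X).codRestrict W h) ∘ₗ W.subtype) := by
  have hle : LinearMap.range (K : X →ₗ[ℂ] X) ≤ W := by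
    rintro _ ⟨x, rfl⟩
    exact h x
  have : FiniteDimensional ℂ (LinearMap.range (K : X →ₗ[ℂ] X)) :=
    Submodule.finiteDimensional_of_le hle
  exact LinearMap.trace_comp_comm' (R := ℂ) (Submodule.inclusion hle)
    ((K : X →ₗ[ℂ] X).rangeRestrict ∘ₗ W.subtype)

theorem finiteRankTrace_add {K L : X →L[ℂ] X} (hK : FiniteRank K) (hL : FiniteRank L) :
    finiteRankTrace (K + L) = finiteRankTrace K + finiteRankTrace L := by
  unfold FiniteRank at hK hL
  let W := LinearMap.range (K : X →ₗ[ℂ] X) ⊔ LinearMap.range (L : X →ₗ[ℂ] X)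
  have hKW : ∀ x, K x ∈ W := fun x => Submodule.mem_sup_left ⟨x, rfl⟩
  have hLW : ∀ x, L x ∈ W := fun x => Submodule.mem_sup_right ⟨x, rfl⟩
  rw [finiteRankTrace_eq hKW, finiteRankTrace_eq hLW,
    finiteRankTrace_eq (K := K + L) fun x => W.add_mem (hKW x) (hLW x), ← map_add]
  rfl

theorem finiteRankTrace_smul {K : X →L[ℂ] X} (hK : FiniteRank K) (c : ℂ) :
    finiteRankTrace (c • K) = c * finiteRankTrace K := by
  unfold FiniteRank at hK
  let W := LinearMap.range (K : X →ₗ[ℂ] X)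
  have hW : ∀ x, K x ∈ W := fun x => ⟨x, rfl⟩
  rw [finiteRankTrace_eq hW, finiteRankTrace_eq (K := c • K) fun x => W.smul_mem c (hW x),
    ← smul_eq_mul, ← map_smul]
  rfl

theorem finiteRankTrace_sub {K L : X →L[ℂ] X} (hK : FiniteRank K) (hL : FiniteRank L) :
    finiteRankTrace (K - L) = finiteRankTrace K - finiteRankTrace L := by
  have hL' : FiniteRank ((-1 : ℂ) • L) := finiteRank_iff.mpr ((finiteRank_iff.mp hL).smul _)
  rw [sub_eq_add_neg, ← neg_one_smul ℂ L, finiteRankTrace_add hK hL', finiteRankTrace_smul hL,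
    neg_one_mul, ← sub_eq_add_neg]

theorem finiteRankTrace_zero : finiteRankTrace (0 : X →L[ℂ] X) = 0 := by
  simpa using finiteRankTrace_smul (finiteRank_zero (X := X)) 0

theorem finiteRankTrace_comp_comm {A : X →L[ℂ] Y} (hA : (A : X →ₗ[ℂ] Y).HasFiniteRange)
    (B : Y →L[ℂ] X) : finiteRankTrace (A ∘L B) = finiteRankTrace (B ∘L A) := by
  let W := LinearMap.range (A : X →ₗ[ℂ] Y)
  have : FiniteDimensional ℂ W := Module.Finite.iff_fg.mpr hA
  let V := W.map (B : Y →ₗ[ℂ] X)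
  have hW : ∀ x, A x ∈ W := fun x => ⟨x, rfl⟩
  have hV : ∀ y ∈ W, B y ∈ V := fun y hy => ⟨y, hy, rfl⟩
  rw [finiteRankTrace_eq (K := A ∘L B) fun y => hW (B y),
    finiteRankTrace_eq (K := B ∘L A) fun x => hV _ (hW x)]
  exact LinearMap.trace_comp_comm' (R := ℂ) ((B : Y →ₗ[ℂ] X).restrict hV)
    ((A : X →ₗ[ℂ] Y).codRestrict W hW ∘ₗ V.subtype)

end FiniteRank

section Meromorphic

variable {X Y Z : Type*} [NormedAddCommGroup X] [NormedSpace ℂ X] [NormedAddCommGroup Y]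
  [NormedSpace ℂ Y] [NormedAddCommGroup Z] [NormedSpace ℂ Z] {z₀ : ℂ}

/-- Finitely meromorphic operator functions at `z₀`, as the smallest class that contains the
analytic functions and the finite rank poles and is closed under sums. The inductive form lets
products and contour integrals be treated term by term. -/
inductive FinMero (z₀ : ℂ) : (ℂ → X →L[ℂ] Y) → Prop
  | analytic {f : ℂ → X →L[ℂ] Y} (hf : AnalyticAt ℂ f z₀) : FinMero z₀ f
  | pole (k : ℕ) {A : X →L[ℂ] Y} (hA : (A : X →ₗ[ℂ] Y).HasFiniteRange) :
      FinMero z₀ fun z => ((z - z₀) ^ k)⁻¹ • A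
  | add {f g : ℂ → X →L[ℂ] Y} (hf : FinMero z₀ f) (hg : FinMero z₀ g) :
      FinMero z₀ fun z => f z + g z
  | congr {f g : ℂ → X →L[ℂ] Y} (hf : FinMero z₀ f) (h : f =ᶠ[𝓝[≠] z₀] g) : FinMero z₀ g

theorem analyticAt_clm_comp {f : ℂ → Y →L[ℂ] Z} {g : ℂ → X →L[ℂ] Y}
    (hf : AnalyticAt ℂ f z₀) (hg : AnalyticAt ℂ g z₀) :
    AnalyticAt ℂ (fun z => f z ∘L g z) z₀ :=
  ((ContinuousLinearMap.compL ℂ X Y Z).analyticAt_bilinear (f z₀, g z₀)).comp₂ hf hg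

theorem exists_analyticAt_eq_add_smul {E : Type*} [NormedAddCommGroup E] [NormedSpace ℂ E]
    {f : ℂ → E} (hf : AnalyticAt ℂ f z₀) :
    ∃ g : ℂ → E, AnalyticAt ℂ g z₀ ∧ ∀ z, f z = f z₀ + (z - z₀) • g z := by
  obtain ⟨p, hp⟩ := hf
  refine ⟨dslope f z₀, ⟨_, hp.has_fpower_series_dslope_fslope⟩, fun z => ?_⟩
  rw [sub_smul_dslope, add_sub_cancel]

theorem FinMero.inv_pow_smul_clm {E : Type*} [NormedAddCommGroup E] [NormedSpace ℂ E]
    (L : E →L[ℂ] X →L[ℂ] Y) (hL : ∀ e, (L e : X →ₗ[ℂ] Y).HasFiniteRange) {f : ℂ → E}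
    (hf : AnalyticAt ℂ f z₀) (k : ℕ) : FinMero z₀ fun z => ((z - z₀) ^ k)⁻¹ • L (f z) := by
  induction k generalizing f with
  | zero => simpa using FinMero.analytic ((L.analyticAt _).fun_comp hf)
  | succ k ih =>
    obtain ⟨g, hg, hfg⟩ := exists_analyticAt_eq_add_smul hf
    refine .congr (.add (.pole (k + 1) (hL (f z₀))) (ih hg)) ?_
    filter_upwards [self_mem_nhdsWithin] with z hz
    have hz' : z - z₀ ≠ 0 := sub_ne_zero.mpr hz
    rw [hfg z, map_add, map_smul, smul_add, smul_smul, pow_succ, mul_inv, inv_mul_cancel_right₀ hz']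

theorem FinMero.comp {f : ℂ → Y →L[ℂ] Z} {g : ℂ → X →L[ℂ] Y} (hf : FinMero z₀ f)
    (hg : FinMero z₀ g) : FinMero z₀ fun z => f z ∘L g z := by
  induction hf with
  | analytic hf =>
    induction hg with
    | analytic hg => exact .analytic (analyticAt_clm_comp hf hg)
    | @pole k A hA =>
      exact .congr (.inv_pow_smul_clm ((ContinuousLinearMap.compL ℂ X Y Z).flip A)
        (fun e => hA.comp_left _) hf k) (.of_forall fun z => by simp)
    | add _ _ h1 h2 => exact .congr (.add h1 h2) (.of_forall fun z => by simp)
    | congr _ h h1 => exact .congr h1 (h.mono fun z hz => by simp [hz])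
  | @pole k A hA =>
    induction hg with
    | analytic hg =>
      exact .congr (.inv_pow_smul_clm (ContinuousLinearMap.compL ℂ X Y Z A)
        (fun e => hA.comp_right _) hg k) (.of_forall fun z => by simp)
    | @pole l B _ =>
      refine .congr (.pole (k + l) (A := A ∘L B) (hA.comp_right _)) (.of_forall fun z => ?_)
      simp [pow_add, smul_smul, mul_comm]
    | add _ _ h1 h2 => exact .congr (.add h1 h2) (.of_forall fun z => by simp)
    | congr _ h h1 => exact .congr h1 (h.mono fun z hz => by simp [hz])
  | add _ _ h1 h2 => exact .congr (.add h1 h2) (.of_forall fun z => by simp)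
  | congr _ h h1 => exact .congr h1 (h.mono fun z hz => by simp [hz])

theorem FinMero.smul {f : ℂ → X →L[ℂ] Y} (hf : FinMero z₀ f) {c : ℂ → ℂ}
    (hc : AnalyticAt ℂ c z₀) : FinMero z₀ fun z => c z • f z :=
  .congr (.comp (.analytic (hc.smul (analyticAt_const (v := .id ℂ Y)))) hf)
    (.of_forall fun z => by ext; simp)

theorem FinMero.neg {f : ℂ → X →L[ℂ] Y} (hf : FinMero z₀ f) : FinMero z₀ fun z => -f z := by
  simpa using hf.smul (analyticAt_const (v := -1))

theorem FinMero.sub {f g : ℂ → X →L[ℂ] Y} (hf : FinMero z₀ f) (hg : FinMero z₀ g) :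
    FinMero z₀ fun z => f z - g z := by
  simpa only [sub_eq_add_neg] using hf.add hg.neg

end Meromorphic

section FinitelyMeromorphicAt

variable {G : Type*} [NormedAddCommGroup G] [InnerProductSpace ℂ G] {z₀ : ℂ}

theorem FinitelyMeromorphicAt.eventually_exists {f : ℂ → G →L[ℂ] G}
    (hf : FinitelyMeromorphicAt f z₀) :
    ∀ᶠ N in atTop, ∃ (A : ℕ → G →L[ℂ] G) (g : ℂ → G →L[ℂ] G),
      (∀ k, FiniteRank (A k)) ∧ AnalyticAt ℂ g z₀ ∧
      ∀ᶠ z in 𝓝[≠] z₀, f z = (∑ k ∈ Finset.Icc 1 N, ((z - z₀) ^ k)⁻¹ • A k) + g z := by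
  obtain ⟨M, A, g, hA, hg, hfg⟩ := hf
  filter_upwards [eventually_ge_atTop M] with N hN
  refine ⟨fun k => if k ≤ M then A k else 0, g, fun k => ?_, hg, hfg.mono fun z hz => ?_⟩
  · beta_reduce
    split_ifs
    exacts [hA k, finiteRank_zero]
  · have hIcc : (Finset.Icc 1 N).filter (· ≤ M) = Finset.Icc 1 M := by
      ext k
      simp only [Finset.mem_filter, Finset.mem_Icc]
      omega
    simp only [smul_ite, smul_zero, ← Finset.sum_filter, hIcc, hz]

theorem FinitelyMeromorphicAt.add {f g : ℂ → G →L[ℂ] G} (hf : FinitelyMeromorphicAt f z₀)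
    (hg : FinitelyMeromorphicAt g z₀) : FinitelyMeromorphicAt (fun z => f z + g z) z₀ := by
  obtain ⟨N, ⟨A, a, hA, ha, hfA⟩, B, b, hB, hb, hgB⟩ :=
    (hf.eventually_exists.and hg.eventually_exists).exists
  refine ⟨N, fun k => A k + B k, fun z => a z + b z,
    fun k => finiteRank_iff.mpr ((finiteRank_iff.mp (hA k)).add (finiteRank_iff.mp (hB k))),
    ha.add hb, ?_⟩
  filter_upwards [hfA, hgB] with z hfz hgz
  simp only [hfz, hgz, smul_add, Finset.sum_add_distrib]
  abel

theorem FinMero.finitelyMeromorphicAt {f : ℂ → G →L[ℂ] G} (hf : FinMero z₀ f) :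
    FinitelyMeromorphicAt f z₀ := by
  induction hf with
  | @analytic f hf =>
    exact ⟨0, 0, f, fun _ => finiteRank_zero, hf, .of_forall fun z => by simp⟩
  | @pole k A hA =>
    rcases Nat.eq_zero_or_pos k with rfl | hk
    · exact ⟨0, 0, fun _ => A, fun _ => finiteRank_zero, analyticAt_const,
        .of_forall fun z => by simp⟩
    · refine ⟨k, fun j => if j = k then A else 0, 0, fun j => ?_, analyticAt_const,
        .of_forall fun z => by simp [Nat.one_le_iff_ne_zero.mpr hk.ne']⟩
      beta_reduce
      split_ifs
      exacts [finiteRank_iff.mpr hA, finiteRank_zero]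
  | add _ _ h1 h2 => exact h1.add h2
  | congr _ h h1 =>
    obtain ⟨N, A, g, hA, hg, hfg⟩ := h1
    exact ⟨N, A, g, hA, hg, (h.and hfg).mono fun z hz => hz.1 ▸ hz.2⟩

end FinitelyMeromorphicAt

section CircleIntegral

variable {E F : Type*} [NormedAddCommGroup E] [NormedSpace ℂ E] [NormedAddCommGroup F]
  [NormedSpace ℂ F] {z₀ : ℂ} {ε : ℝ}

theorem eventually_forall_sphere {p : ℂ → Prop} (h : ∀ᶠ z in 𝓝[≠] z₀, p z) :
    ∀ᶠ ε in 𝓝[>] (0 : ℝ), ∀ z ∈ sphere z₀ ε, p z := by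
  rw [eventually_nhdsWithin_iff, Metric.eventually_nhds_iff] at h
  obtain ⟨r, hr, hp⟩ := h
  filter_upwards [Ioo_mem_nhdsGT hr] with ε hε z hz
  exact hp (hz.trans_lt hε.2) (ne_of_mem_sphere hz hε.1.ne')

theorem eventually_differentiableOn_closedBall [CompleteSpace E] {f : ℂ → E}
    (hf : AnalyticAt ℂ f z₀) :
    ∀ᶠ ε in 𝓝[>] (0 : ℝ), DifferentiableOn ℂ f (closedBall z₀ ε) := by
  obtain ⟨r, hr, hp⟩ := Metric.eventually_nhds_iff.mp hf.eventually_analyticAt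
  filter_upwards [Ioo_mem_nhdsGT hr] with ε hε z hz
  exact (hp (lt_of_le_of_lt hz hε.2)).differentiableAt.differentiableWithinAt

theorem continuousOn_sphere_inv_pow (hε : 0 < ε) (k : ℕ) :
    ContinuousOn (fun z : ℂ => ((z - z₀) ^ k)⁻¹) (sphere z₀ ε) :=
  ContinuousOn.inv₀ (by fun_prop) fun _ hz =>
    pow_ne_zero _ (sub_ne_zero.mpr (ne_of_mem_sphere hz hε.ne'))

theorem circleIntegral_eq_zero_of_differentiableOn {f : ℂ → E} (hε : 0 ≤ ε)
    (hf : DifferentiableOn ℂ f (closedBall z₀ ε)) : (∮ z in C(z₀, ε), f z) = 0 :=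
  (hf.mono closure_ball_subset_closedBall).diffContOnCl.circleIntegral_eq_zero hε

theorem circleIntegral_eq_of_analyticAt_punctured {f : ℂ → E} {δ : ℝ}
    (hf : ∀ z ∈ closedBall z₀ ε \ {z₀}, AnalyticAt ℂ f z) (hδ : 0 < δ) (hδε : δ ≤ ε) :
    (∮ z in C(z₀, ε), f z) = ∮ z in C(z₀, δ), f z := by
  refine Complex.circleIntegral_eq_of_differentiable_on_annulus_off_countable hδ hδε
    Set.countable_empty (fun z hz => (hf z ⟨hz.1, ?_⟩).continuousAt.continuousWithinAt)
    fun z hz => (hf z ⟨ball_subset_closedBall hz.1.1, ?_⟩).differentiableAt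
  · rintro rfl
    exact hz.2 (mem_ball_self hδ)
  · rintro rfl
    exact hz.1.2 (mem_closedBall_self hδ.le)

theorem circleIntegrable_clm (L : E →L[ℂ] F) {f : ℂ → E} (hf : CircleIntegrable f z₀ ε) :
    CircleIntegrable (fun z => L (f z)) z₀ ε :=
  ⟨L.integrable_comp hf.1, L.integrable_comp hf.2⟩

theorem circleIntegral_clm [CompleteSpace E] [CompleteSpace F] (L : E →L[ℂ] F) {f : ℂ → E}
    (hf : CircleIntegrable f z₀ ε) : (∮ z in C(z₀, ε), L (f z)) = L (∮ z in C(z₀, ε), f z) := by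
  simp only [circleIntegral, ← map_smul]
  exact L.intervalIntegral_comp_comm hf.out

end CircleIntegral

section TraceSymm

variable {X Y : Type*} [NormedAddCommGroup X] [InnerProductSpace ℂ X] [NormedAddCommGroup Y]
  [InnerProductSpace ℂ Y] {z₀ : ℂ} {ε : ℝ}

/-- Cyclicity of the trace under the contour integral over `C(z₀;ε)`: the circle integrals of `f g`
and of `g f` exist, have finite rank and have the same trace. -/
structure TraceSymm (z₀ : ℂ) (ε : ℝ) (f : ℂ → X →L[ℂ] Y) (g : ℂ → Y →L[ℂ] X) : Prop where
  integrable : CircleIntegrable (fun z => f z ∘L g z) z₀ ε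
  integrable_swap : CircleIntegrable (fun z => g z ∘L f z) z₀ ε
  finiteRank : FiniteRank (∮ z in C(z₀, ε), f z ∘L g z)
  finiteRank_swap : FiniteRank (∮ z in C(z₀, ε), g z ∘L f z)
  trace_eq : finiteRankTrace (∮ z in C(z₀, ε), f z ∘L g z) =
    finiteRankTrace (∮ z in C(z₀, ε), g z ∘L f z)

namespace TraceSymm

variable {f f₁ f₂ : ℂ → X →L[ℂ] Y} {g : ℂ → Y →L[ℂ] X}

theorem symm (h : TraceSymm z₀ ε f g) : TraceSymm z₀ ε g f :=
  ⟨h.integrable_swap, h.integrable, h.finiteRank_swap, h.finiteRank, h.trace_eq.symm⟩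

theorem add (h₁ : TraceSymm z₀ ε f₁ g) (h₂ : TraceSymm z₀ ε f₂ g) :
    TraceSymm z₀ ε (fun z => f₁ z + f₂ z) g := by
  have hadd := circleIntegral.integral_add h₁.integrable h₂.integrable
  have hadd' := circleIntegral.integral_add h₁.integrable_swap h₂.integrable_swap
  constructor <;> simp only [ContinuousLinearMap.add_comp, ContinuousLinearMap.comp_add]
  · exact h₁.integrable.add h₂.integrable
  · exact h₁.integrable_swap.add h₂.integrable_swap
  · rw [hadd, finiteRank_iff]
    exact (finiteRank_iff.mp h₁.finiteRank).add (finiteRank_iff.mp h₂.finiteRank)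
  · rw [hadd', finiteRank_iff]
    exact (finiteRank_iff.mp h₁.finiteRank_swap).add (finiteRank_iff.mp h₂.finiteRank_swap)
  · rw [hadd, hadd', finiteRankTrace_add h₁.finiteRank h₂.finiteRank,
      finiteRankTrace_add h₁.finiteRank_swap h₂.finiteRank_swap, h₁.trace_eq, h₂.trace_eq]

theorem congr (hε : 0 ≤ ε) (h₁ : TraceSymm z₀ ε f₁ g) (h : Set.EqOn f₁ f₂ (sphere z₀ ε)) :
    TraceSymm z₀ ε f₂ g := by
  have hfg : Set.EqOn (fun z => f₁ z ∘L g z) (fun z => f₂ z ∘L g z) (sphere z₀ ε) :=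
    fun z hz => by simp only [h hz]
  have hgf : Set.EqOn (fun z => g z ∘L f₁ z) (fun z => g z ∘L f₂ z) (sphere z₀ ε) :=
    fun z hz => by simp only [h hz]
  have hint := circleIntegral.integral_congr hε hfg
  have hint' := circleIntegral.integral_congr hε hgf
  rw [← abs_of_nonneg hε] at hfg hgf
  exact ⟨(circleIntegrable_congr hfg).mp h₁.integrable,
    (circleIntegrable_congr hgf).mp h₁.integrable_swap, hint ▸ h₁.finiteRank,
    hint' ▸ h₁.finiteRank_swap, hint ▸ hint' ▸ h₁.trace_eq⟩

variable [CompleteSpace X] [CompleteSpace Y]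

theorem of_pole (hε : 0 < ε) (hf : ContinuousOn f (sphere z₀ ε)) (k : ℕ) {A : Y →L[ℂ] X}
    (hA : (A : Y →ₗ[ℂ] X).HasFiniteRange) :
    TraceSymm z₀ ε f fun z => ((z - z₀) ^ k)⁻¹ • A := by
  have hF : CircleIntegrable (fun z => ((z - z₀) ^ k)⁻¹ • f z) z₀ ε :=
    ((continuousOn_sphere_inv_pow hε k).smul hf).circleIntegrable hε.le
  let L := (ContinuousLinearMap.compL ℂ Y X Y).flip A
  let R := ContinuousLinearMap.compL ℂ X Y X A
  have hL : (∮ z in C(z₀, ε), f z ∘L (((z - z₀) ^ k)⁻¹ • A)) =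
      (∮ z in C(z₀, ε), ((z - z₀) ^ k)⁻¹ • f z) ∘L A := by
    simpa [L] using circleIntegral_clm L hF
  have hR : (∮ z in C(z₀, ε), (((z - z₀) ^ k)⁻¹ • A) ∘L f z) =
      A ∘L ∮ z in C(z₀, ε), ((z - z₀) ^ k)⁻¹ • f z := by
    simpa [R] using circleIntegral_clm R hF
  constructor
  · simpa [L] using circleIntegrable_clm L hF
  · simpa [R] using circleIntegrable_clm R hF
  · rw [hL, finiteRank_iff]
    exact hA.comp_left _
  · rw [hR, finiteRank_iff]
    exact hA.comp_right _
  · rw [hL, hR, finiteRankTrace_comp_comm hA]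

theorem of_differentiableOn (hε : 0 ≤ ε) (hf : DifferentiableOn ℂ f (closedBall z₀ ε))
    (hg : DifferentiableOn ℂ g (closedBall z₀ ε)) : TraceSymm z₀ ε f g := by
  have hfg : DifferentiableOn ℂ (fun z => f z ∘L g z) (closedBall z₀ ε) := hf.clm_comp hg
  have hgf : DifferentiableOn ℂ (fun z => g z ∘L f z) (closedBall z₀ ε) := hg.clm_comp hf
  have hint := circleIntegral_eq_zero_of_differentiableOn hε hfg
  have hint' := circleIntegral_eq_zero_of_differentiableOn hε hgf
  refine ⟨(hfg.continuousOn.mono sphere_subset_closedBall).circleIntegrable hε,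
    (hgf.continuousOn.mono sphere_subset_closedBall).circleIntegrable hε, ?_, ?_, ?_⟩
  · rw [hint]
    exact finiteRank_zero
  · rw [hint']
    exact finiteRank_zero
  · rw [hint, hint', finiteRankTrace_zero, finiteRankTrace_zero]

end TraceSymm

namespace FinMero

variable {f : ℂ → X →L[ℂ] Y} {g : ℂ → Y →L[ℂ] X}

theorem eventually_continuousOn_sphere [CompleteSpace Y] (hf : FinMero z₀ f) :
    ∀ᶠ ε in 𝓝[>] (0 : ℝ), ContinuousOn f (sphere z₀ ε) := by
  induction hf with
  | analytic hf =>
    filter_upwards [eventually_differentiableOn_closedBall hf] with ε hε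
    exact hε.continuousOn.mono sphere_subset_closedBall
  | pole k _ =>
    filter_upwards [self_mem_nhdsWithin] with ε hε
    exact (continuousOn_sphere_inv_pow hε k).smul continuousOn_const
  | add _ _ h1 h2 => filter_upwards [h1, h2] with ε h1 h2 using h1.add h2
  | congr _ h h1 =>
    filter_upwards [h1, eventually_forall_sphere h] with ε h1 h
    exact h1.congr fun z hz => (h z hz).symm

variable [CompleteSpace X] [CompleteSpace Y]

theorem traceSymm_of_analyticAt (hf : AnalyticAt ℂ f z₀) (hg : FinMero z₀ g) :
    ∀ᶠ ε in 𝓝[>] (0 : ℝ), TraceSymm z₀ ε g f := by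
  induction hg with
  | analytic hg =>
    filter_upwards [self_mem_nhdsWithin, eventually_differentiableOn_closedBall hf,
      eventually_differentiableOn_closedBall hg] with ε hε hf hg
    exact .of_differentiableOn (le_of_lt hε) hg hf
  | pole k hA =>
    filter_upwards [self_mem_nhdsWithin, eventually_continuousOn_sphere (.analytic hf)]
      with ε hε hf
    exact (TraceSymm.of_pole hε hf k hA).symm
  | add _ _ h1 h2 => filter_upwards [h1, h2] with ε h1 h2 using h1.add h2
  | congr _ h h1 =>
    filter_upwards [self_mem_nhdsWithin, h1, eventually_forall_sphere h] with ε hε h1 h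
    exact h1.congr (le_of_lt hε) h

theorem traceSymm (hf : FinMero z₀ f) (hg : FinMero z₀ g) :
    ∀ᶠ ε in 𝓝[>] (0 : ℝ), TraceSymm z₀ ε f g := by
  induction hf with
  | analytic hf => exact (traceSymm_of_analyticAt hf hg).mono fun ε h => h.symm
  | pole k hA =>
    filter_upwards [self_mem_nhdsWithin, hg.eventually_continuousOn_sphere] with ε hε hg
    exact (TraceSymm.of_pole hε hg k hA).symm
  | add _ _ h1 h2 => filter_upwards [h1, h2] with ε h1 h2 using h1.add h2
  | congr _ h h1 =>
    filter_upwards [self_mem_nhdsWithin, h1, eventually_forall_sphere h] with ε hε h1 h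
    exact h1.congr (le_of_lt hε) h

end FinMero

end TraceSymm

section Resolvent

variable {H : Type*} [NormedAddCommGroup H] [InnerProductSpace ℂ H] {T : H →ₗ.[ℂ] H} {z w : ℂ}

theorem IsBoundedInverse.eq {R R' : H →L[ℂ] H} (h : IsBoundedInverse T R)
    (h' : IsBoundedInverse T R') : R = R' := by
  ext y
  obtain ⟨hy, hTy⟩ := h.1 y
  simpa only [hTy] using (h'.2 ⟨R y, hy⟩).symm

theorem isBoundedInverse_boundedInverse (h : BoundedlyInvertible T) :
    IsBoundedInverse T (boundedInverse T) := by
  rw [boundedInverse, dif_pos h]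
  exact h.choose_spec

theorem IsBoundedInverse.boundedInverse_eq {R : H →L[ℂ] H} (h : IsBoundedInverse T R) :
    boundedInverse T = R :=
  (isBoundedInverse_boundedInverse ⟨R, h⟩).eq h

theorem BoundedlyInvertible.isClosed (h : BoundedlyInvertible T) : T.IsClosed := by
  obtain ⟨R, hR⟩ := h
  have hgraph : (T.graph : Set (H × H)) = {p | R p.2 = p.1} := by
    ext ⟨x, y⟩
    simp only [SetLike.mem_coe, LinearPMap.mem_graph_iff, Set.mem_ofPred_eq]
    constructor
    · rintro ⟨v, rfl, rfl⟩
      exact hR.2 v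
    · rintro rfl
      obtain ⟨hy, hTy⟩ := hR.1 y
      exact ⟨⟨R y, hy⟩, rfl, hTy⟩
  rw [LinearPMap.IsClosed, hgraph]
  exact isClosed_eq (by fun_prop) continuous_fst

theorem resolventOp_mem (hz : z ∈ resSet T) (y : H) :
    ∃ h : resolventOp T z y ∈ T.domain,
      T ⟨resolventOp T z y, h⟩ = y + z • resolventOp T z y := by
  obtain ⟨h, hTy⟩ := (isBoundedInverse_boundedInverse hz).1 y
  exact ⟨h, sub_eq_iff_eq_add.mp hTy⟩

theorem resolventOp_apply_sub (hz : z ∈ resSet T) (x : T.domain) :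
    resolventOp T z (T x - z • (x : H)) = x :=
  (isBoundedInverse_boundedInverse hz).2 x

theorem resolventOp_injective (hz : z ∈ resSet T) : Function.Injective (resolventOp T z) := by
  intro y y' hyy'
  obtain ⟨hy, hTy⟩ := (isBoundedInverse_boundedInverse hz).1 y
  obtain ⟨hy', hTy'⟩ := (isBoundedInverse_boundedInverse hz).1 y'
  rw [← hTy, ← hTy']
  exact congrArg (shift T z) (Subtype.ext hyy')

theorem resolventOp_sub (hz : z ∈ resSet T) (hw : w ∈ resSet T) :
    resolventOp T z - resolventOp T w = (z - w) • (resolventOp T z ∘L resolventOp T w) := by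
  ext y
  obtain ⟨hy, hTy⟩ := resolventOp_mem hw y
  have hR := resolventOp_apply_sub hz ⟨resolventOp T w y, hy⟩
  rw [hTy, add_sub_assoc, ← sub_smul, map_add, map_smul] at hR
  calc resolventOp T z y - resolventOp T w y
      = resolventOp T z y -
          (resolventOp T z y + (w - z) • resolventOp T z (resolventOp T w y)) := by rw [hR]
    _ = (z - w) • resolventOp T z (resolventOp T w y) := by module

theorem resolventOp_comm (hz : z ∈ resSet T) (hw : w ∈ resSet T) :
    resolventOp T z ∘L resolventOp T w = resolventOp T w ∘L resolventOp T z := by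
  rcases eq_or_ne z w with rfl | hne
  · rfl
  refine smul_right_injective _ (sub_ne_zero.mpr hne) ?_
  beta_reduce
  rw [← resolventOp_sub hz hw, ← neg_sub w z, neg_smul, ← resolventOp_sub hw hz, neg_sub]

theorem mem_kerPow_succ {n : ℕ} {x : H} :
    x ∈ kerPow T z (n + 1) ↔ ∃ h : x ∈ T.domain, T ⟨x, h⟩ - z • x ∈ kerPow T z n := by
  constructor
  · rintro ⟨y, hy, rfl⟩
    exact ⟨y.2, hy⟩
  · rintro ⟨h, h'⟩
    exact ⟨⟨x, h⟩, h', rfl⟩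

theorem isBoundedInverse_shift_of_mul_eq_one (hw : w ∈ resSet T) {V : H →L[ℂ] H}
    (hV : (1 - (z - w) • resolventOp T w) * V = 1)
    (hV' : V * (1 - (z - w) • resolventOp T w) = 1) :
    IsBoundedInverse (shift T z) (resolventOp T w ∘L V) := by
  constructor
  · intro y
    obtain ⟨h, hTVy⟩ := resolventOp_mem hw (V y)
    have hy : V y - (z - w) • resolventOp T w (V y) = y := DFunLike.congr_fun hV y
    refine ⟨h, ?_⟩
    calc T ⟨resolventOp T w (V y), h⟩ - z • resolventOp T w (V y)
        = V y - (z - w) • resolventOp T w (V y) := by rw [hTVy]; module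
      _ = y := hy
  · intro x
    have hx := resolventOp_apply_sub hw x
    have hVx : V (T x - w • (x : H) - (z - w) • resolventOp T w (T x - w • (x : H))) =
        T x - w • (x : H) := DFunLike.congr_fun hV' _
    calc resolventOp T w (V (T x - z • (x : H)))
        = resolventOp T w (V (T x - w • (x : H) - (z - w) • (x : H))) := by congr 2; module
      _ = x := by rw [hx] at hVx; rw [hVx, hx]

variable [CompleteSpace H]

theorem exists_analyticAt_isBoundedInverse_shift (hw : w ∈ resSet T) :
    ∃ F : ℂ → H →L[ℂ] H, AnalyticAt ℂ F w ∧
      ∀ᶠ z in 𝓝 w, IsBoundedInverse (shift T z) (F z) := by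
  let U : ℂ → H →L[ℂ] H := fun z => 1 - (z - w) • resolventOp T w
  have hU : AnalyticAt ℂ U w := by fun_prop
  have hUw : U w = 1 := by simp [U]
  have hinv : AnalyticAt ℂ (fun z => Ring.inverse (U z)) w := by
    refine AnalyticAt.comp (g := Ring.inverse) ?_ hU
    rw [hUw]
    exact analyticAt_inverse (1 : (H →L[ℂ] H)ˣ)
  have hunit : ∀ᶠ z in 𝓝 w, IsUnit (U z) := by
    refine hU.continuousAt.eventually (p := IsUnit) ?_
    rw [hUw]
    exact Units.nhds (1 : (H →L[ℂ] H)ˣ)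
  refine ⟨fun z => resolventOp T w ∘L Ring.inverse (U z),
    analyticAt_clm_comp analyticAt_const hinv, hunit.mono fun z hz => ?_⟩
  exact isBoundedInverse_shift_of_mul_eq_one hw (Ring.mul_inverse_cancel _ hz)
    (Ring.inverse_mul_cancel _ hz)

theorem analyticAt_resolventOp (hw : w ∈ resSet T) : AnalyticAt ℂ (resolventOp T) w := by
  obtain ⟨F, hF, h⟩ := exists_analyticAt_isBoundedInverse_shift hw
  exact hF.congr (h.mono fun z hz => hz.boundedInverse_eq.symm)

theorem isOpen_resSet : IsOpen (resSet T) := by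
  rw [isOpen_iff_mem_nhds]
  intro w hw
  obtain ⟨F, -, h⟩ := exists_analyticAt_isBoundedInverse_shift hw
  exact h.mono fun z hz => ⟨F z, hz⟩

end Resolvent

section Nilpotent

theorem isNilpotent_of_forall_hasEigenvalue {K V : Type*} [Field K] [IsAlgClosed K]
    [AddCommGroup V] [Module K V] [FiniteDimensional K V] {f : Module.End K V}
    (h : ∀ μ, f.HasEigenvalue μ → μ = 0) : IsNilpotent f := by
  have hroots : f.charpoly.roots = Multiset.replicate (Module.finrank K V) 0 := by
    refine Multiset.eq_replicate.mpr ⟨?_, fun μ hμ => h μ ?_⟩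
    · rw [← (IsAlgClosed.splits f.charpoly).natDegree_eq_card_roots, f.charpoly_natDegree]
    · exact (f.hasEigenvalue_iff_isRoot_charpoly μ).mpr (Polynomial.isRoot_of_mem_roots hμ)
  rw [LinearMap.isNilpotent_iff_charpoly,
    (IsAlgClosed.splits f.charpoly).eq_prod_roots_of_monic f.charpoly_monic, hroots]
  simp

end Nilpotent

section Riesz

variable {H : Type*} [NormedAddCommGroup H] [InnerProductSpace ℂ H]
  {T : H →ₗ.[ℂ] H} {z₀ : ℂ} {δ ε r : ℝ}

/-- The disc `D(z₀;r)` exhibits `z₀` as a point of `σ_d(T) ∪ ρ(T)`: apart from `z₀` it lies in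
`ρ(T)`, and the Riesz projections over the circles inside it have finite rank. -/
structure IsIsolatingDisc (T : H →ₗ.[ℂ] H) (z₀ : ℂ) (r : ℝ) : Prop where
  pos : 0 < r
  subset_resSet : ball z₀ r \ {z₀} ⊆ resSet T
  finiteRank : ∀ ε ∈ Set.Ioo 0 r, FiniteRank (rieszProjection T z₀ ε)

namespace IsIsolatingDisc

theorem closedBall_diff_subset (h : IsIsolatingDisc T z₀ r) (hε : ε < r) :
    closedBall z₀ ε \ {z₀} ⊆ resSet T :=
  (Set.sdiff_subset_sdiff_left (closedBall_subset_ball hε)).trans h.subset_resSet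

theorem mono (h : IsIsolatingDisc T z₀ r) (hδ : 0 < δ) (hδr : δ ≤ r) : IsIsolatingDisc T z₀ δ where
  pos := hδ
  subset_resSet := (Set.sdiff_subset_sdiff_left (ball_subset_ball hδr)).trans h.subset_resSet
  finiteRank ε hε := h.finiteRank ε ⟨hε.1, hε.2.trans_le hδr⟩

end IsIsolatingDisc

theorem sphere_subset_closedBall_diff (hε : 0 < ε) :
    sphere z₀ ε ⊆ closedBall z₀ ε \ {z₀} := fun _ hz =>
  ⟨sphere_subset_closedBall hz, ne_of_mem_sphere hz hε.ne'⟩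

theorem eventually_mem_ball_diff (hε : 0 < ε) : ∀ᶠ z in 𝓝[≠] z₀, z ∈ ball z₀ ε \ {z₀} :=
  inter_mem_inf (ball_mem_nhds z₀ hε) (mem_principal_self _)

theorem IsIsolatingDisc.eventually_mem_resSet (h : IsIsolatingDisc T z₀ r) :
    ∀ᶠ z in 𝓝[≠] z₀, z ∈ resSet T :=
  (eventually_mem_ball_diff h.pos).mono h.subset_resSet

variable [CompleteSpace H]

theorem circleIntegrable_resolventOp (hε : 0 < ε) (hρ : closedBall z₀ ε \ {z₀} ⊆ resSet T) :
    CircleIntegrable (resolventOp T) z₀ ε :=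
  ContinuousOn.circleIntegrable hε.le fun _ hz => (analyticAt_resolventOp
    (hρ (sphere_subset_closedBall_diff hε hz))).continuousAt.continuousWithinAt

theorem clm_rieszProjection {E : Type*} [NormedAddCommGroup E] [NormedSpace ℂ E]
    [CompleteSpace E] (L : (H →L[ℂ] H) →L[ℂ] E) (hε : 0 < ε)
    (hρ : closedBall z₀ ε \ {z₀} ⊆ resSet T) :
    L (rieszProjection T z₀ ε) =
      -((2 * Real.pi * Complex.I : ℂ)⁻¹ • ∮ ζ in C(z₀, ε), L (resolventOp T ζ)) := by
  rw [rieszProjection, map_neg, map_smul,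
    circleIntegral_clm L (circleIntegrable_resolventOp hε hρ)]

theorem rieszProjection_comm (hε : 0 < ε) (hρ : closedBall z₀ ε \ {z₀} ⊆ resSet T) {z : ℂ}
    (hz : z ∈ resSet T) :
    resolventOp T z ∘L rieszProjection T z₀ ε = rieszProjection T z₀ ε ∘L resolventOp T z := by
  have hl := clm_rieszProjection (ContinuousLinearMap.compL ℂ H H H (resolventOp T z)) hε hρ
  have hr := clm_rieszProjection
    ((ContinuousLinearMap.compL ℂ H H H).flip (resolventOp T z)) hε hρ
  refine hl.trans (Eq.trans ?_ hr.symm)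
  congr 2
  exact circleIntegral.integral_congr hε.le fun ζ hζ =>
    resolventOp_comm hz (hρ (sphere_subset_closedBall_diff hε hζ))

theorem rieszProjection_radius_independent (hρ : closedBall z₀ ε \ {z₀} ⊆ resSet T)
    (hδ : 0 < δ) (hδε : δ ≤ ε) : rieszProjection T z₀ ε = rieszProjection T z₀ δ := by
  rw [rieszProjection, rieszProjection, circleIntegral_eq_of_analyticAt_punctured
    (fun z hz => analyticAt_resolventOp (hρ hz)) hδ hδε]

/-- The regular part at `z₀` of the resolvent of `T`, as the Cauchy integral of the resolvent over
`C(z₀;ε)`; the Laurent expansion of the resolvent at `z₀` splits it off from the principal part. -/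
noncomputable def regularPart (T : H →ₗ.[ℂ] H) (z₀ : ℂ) (ε : ℝ) (z : ℂ) : H →L[ℂ] H :=
  (2 * Real.pi * Complex.I : ℂ)⁻¹ • ∮ ζ in C(z₀, ε), (ζ - z)⁻¹ • resolventOp T ζ

theorem analyticAt_regularPart (hε : 0 < ε) (hρ : closedBall z₀ ε \ {z₀} ⊆ resSet T) {z : ℂ}
    (hz : z ∈ ball z₀ ε) : AnalyticAt ℂ (regularPart T z₀ ε) z := by
  have hint := circleIntegrable_resolventOp hε hρ
  lift ε to NNReal using hε.le
  exact (hasFPowerSeriesOn_cauchy_integral hint (by exact_mod_cast hε)).analyticOnNhd z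
    (by simpa using hz)

theorem resolventOp_sub_comp_rieszProjection (hε : 0 < ε)
    (hρ : closedBall z₀ ε \ {z₀} ⊆ resSet T) {z : ℂ} (hz : z ∈ ball z₀ ε \ {z₀}) :
    resolventOp T z - resolventOp T z ∘L rieszProjection T z₀ ε = regularPart T z₀ ε z := by
  have hzρ : z ∈ resSet T := hρ ⟨ball_subset_closedBall hz.1, hz.2⟩
  have hne : ∀ ζ ∈ sphere z₀ ε, ζ - z ≠ 0 := fun ζ hζ =>
    sub_ne_zero.mpr (sphere_disjoint_ball.ne_of_mem hζ hz.1)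
  let L := ContinuousLinearMap.compL ℂ H H H (resolventOp T z)
  have hcongr : Set.EqOn (fun ζ => (ζ - z)⁻¹ • resolventOp T ζ)
      (fun ζ => (ζ - z)⁻¹ • resolventOp T z + L (resolventOp T ζ)) (sphere z₀ ε) := by
    intro ζ hζ
    have hζρ := hρ (sphere_subset_closedBall_diff hε hζ)
    have hsub := resolventOp_sub hζρ hzρ
    rw [resolventOp_comm hζρ hzρ, sub_eq_iff_eq_add'] at hsub
    calc (ζ - z)⁻¹ • resolventOp T ζ
        = (ζ - z)⁻¹ • (resolventOp T z + (ζ - z) • L (resolventOp T ζ)) := congrArg _ hsub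
      _ = _ := by rw [smul_add, inv_smul_smul₀ (hne ζ hζ)]
  have hint : CircleIntegrable (fun ζ => (ζ - z)⁻¹ • resolventOp T z) z₀ ε :=
    ((ContinuousOn.inv₀ (by fun_prop) hne).smul continuousOn_const).circleIntegrable hε.le
  have hL : L (rieszProjection T z₀ ε) =
      -((2 * Real.pi * Complex.I : ℂ)⁻¹ • ∮ ζ in C(z₀, ε), L (resolventOp T ζ)) :=
    clm_rieszProjection L hε hρ
  rw [regularPart, circleIntegral.integral_congr hε.le hcongr, circleIntegral.integral_add hint
    (circleIntegrable_clm L (circleIntegrable_resolventOp hε hρ)),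
    circleIntegral.integral_smul_const, circleIntegral.integral_sub_inv_of_mem_ball hz.1,
    smul_add, inv_smul_smul₀ Complex.two_pi_I_ne_zero, ← neg_neg (_ • _), ← hL, ← sub_eq_add_neg]
  rfl

theorem rieszProjection_idempotent (hε : 0 < ε) (hρ : closedBall z₀ ε \ {z₀} ⊆ resSet T) :
    IsIdempotentElem (rieszProjection T z₀ ε) := by
  have hδ : 0 < ε / 2 := half_pos hε
  have hδε : ε / 2 < ε := half_lt_self hε
  let L := (ContinuousLinearMap.compL ℂ H H H).flip (1 - rieszProjection T z₀ ε)
  have hcongr : Set.EqOn (fun z => L (resolventOp T z)) (regularPart T z₀ ε)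
      (sphere z₀ (ε / 2)) := by
    intro z hz
    rw [← resolventOp_sub_comp_rieszProjection hε hρ ⟨sphere_subset_ball hδε hz,
      ne_of_mem_sphere hz hδ.ne'⟩]
    simp [L, ContinuousLinearMap.one_def]
  have hreg : (∮ z in C(z₀, ε / 2), regularPart T z₀ ε z) = 0 :=
    circleIntegral_eq_zero_of_differentiableOn hδ.le fun z hz => (analyticAt_regularPart hε hρ
      (closedBall_subset_ball hδε hz)).differentiableAt.differentiableWithinAt
  have hL : L (rieszProjection T z₀ ε) = 0 := by
    rw [rieszProjection_radius_independent hρ hδ hδε.le, clm_rieszProjection L hδ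
      ((Set.sdiff_subset_sdiff_left (closedBall_subset_closedBall hδε.le)).trans hρ),
      circleIntegral.integral_congr hδ.le hcongr, hreg, smul_zero, neg_zero]
  have hmul : rieszProjection T z₀ ε * (1 - rieszProjection T z₀ ε) = 0 := hL
  rw [mul_sub, mul_one, sub_eq_zero] at hmul
  exact hmul.symm

theorem rieszProjection_apply_of_mem_range (hε : 0 < ε)
    (hρ : closedBall z₀ ε \ {z₀} ⊆ resSet T) {x : H}
    (hx : x ∈ LinearMap.range (rieszProjection T z₀ ε : H →ₗ[ℂ] H)) :
    rieszProjection T z₀ ε x = x := by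
  obtain ⟨y, rfl⟩ := hx
  exact DFunLike.congr_fun (rieszProjection_idempotent hε hρ) y

theorem range_rieszProjection_invariant (hε : 0 < ε) (hρ : closedBall z₀ ε \ {z₀} ⊆ resSet T)
    (hfin : FiniteRank (rieszProjection T z₀ ε)) {x : H}
    (hx : x ∈ LinearMap.range (rieszProjection T z₀ ε : H →ₗ[ℂ] H)) :
    ∃ h : x ∈ T.domain, T ⟨x, h⟩ ∈ LinearMap.range (rieszProjection T z₀ ε : H →ₗ[ℂ] H) := by
  unfold FiniteRank at hfin
  set V := LinearMap.range (rieszProjection T z₀ ε : H →ₗ[ℂ] H)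
  obtain ⟨w, hw⟩ := NormedSpace.sphere_nonempty (x := z₀) |>.mpr hε.le
  have hwρ := hρ (sphere_subset_closedBall_diff hε hw)
  have hinv : ∀ y ∈ V, (resolventOp T w : H →ₗ[ℂ] H) y ∈ V := by
    rintro _ ⟨y, rfl⟩
    exact ⟨resolventOp T w y, (DFunLike.congr_fun (rieszProjection_comm hε hρ hwρ) y).symm⟩
  -- The resolvent is injective on the finite-dimensional space `V`, hence onto `V`.
  have hsurj : Function.Surjective ((resolventOp T w : H →ₗ[ℂ] H).restrict hinv) :=
    LinearMap.injective_iff_surjective.mp fun a b hab =>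
      Subtype.ext (resolventOp_injective hwρ (congrArg Subtype.val hab))
  obtain ⟨y, hy⟩ := hsurj ⟨x, hx⟩
  obtain rfl : resolventOp T w y = x := congrArg Subtype.val hy
  obtain ⟨h, hTy⟩ := resolventOp_mem hwρ (y : H)
  exact ⟨h, hTy ▸ V.add_mem y.2 (V.smul_mem _ hx)⟩

theorem rieszProjection_apply_eq_zero_of_eigenvector (hε : 0 < ε)
    (hρ : closedBall z₀ ε \ {z₀} ⊆ resSet T) {x : T.domain} {μ : ℂ} (hμ : T x = μ • (x : H))
    (hμε : μ ∉ closedBall z₀ ε) : rieszProjection T z₀ ε x = 0 := by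
  have hne : ∀ ζ ∈ closedBall z₀ ε, μ - ζ ≠ 0 := fun ζ hζ =>
    sub_ne_zero.mpr (ne_of_mem_of_not_mem hζ hμε).symm
  have hcongr : Set.EqOn (fun ζ => resolventOp T ζ x) (fun ζ => (μ - ζ)⁻¹ • (x : H))
      (sphere z₀ ε) := by
    intro ζ hζ
    have hRx := resolventOp_apply_sub (hρ (sphere_subset_closedBall_diff hε hζ)) x
    rw [hμ, ← sub_smul, map_smul] at hRx
    exact (eq_inv_smul_iff₀ (hne ζ (sphere_subset_closedBall hζ))).mpr hRx
  have hint : (∮ ζ in C(z₀, ε), (μ - ζ)⁻¹ • (x : H)) = 0 :=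
    circleIntegral_eq_zero_of_differentiableOn hε.le
      ((DifferentiableOn.inv (by fun_prop) hne).smul_const _)
  calc rieszProjection T z₀ ε x
      = -((2 * Real.pi * Complex.I : ℂ)⁻¹ • ∮ ζ in C(z₀, ε), resolventOp T ζ x) :=
        clm_rieszProjection (ContinuousLinearMap.apply ℂ H (x : H)) hε hρ
    _ = 0 := by rw [circleIntegral.integral_congr hε.le hcongr, hint, smul_zero, neg_zero]

theorem eigenvalue_eq_of_mem_range_rieszProjection (hε : 0 < ε)
    (hρ : closedBall z₀ ε \ {z₀} ⊆ resSet T) {x : T.domain} {μ : ℂ} (hμ : T x = μ • (x : H))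
    (hx : (x : H) ∈ LinearMap.range (rieszProjection T z₀ ε : H →ₗ[ℂ] H)) (hx0 : (x : H) ≠ 0) :
    μ = z₀ := by
  by_contra hne
  by_cases hμε : μ ∈ closedBall z₀ ε
  · have hRx := resolventOp_apply_sub (hρ ⟨hμε, hne⟩) x
    rw [hμ, sub_self, map_zero] at hRx
    exact hx0 hRx.symm
  · rw [← rieszProjection_apply_of_mem_range hε hρ hx] at hx0
    exact hx0 (rieszProjection_apply_eq_zero_of_eigenvector hε hρ hμ hμε)

theorem exists_isNilpotent_range_rieszProjection (hε : 0 < ε)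
    (hρ : closedBall z₀ ε \ {z₀} ⊆ resSet T) (hfin : FiniteRank (rieszProjection T z₀ ε)) :
    ∃ N : Module.End ℂ (LinearMap.range (rieszProjection T z₀ ε : H →ₗ[ℂ] H)),
      IsNilpotent N ∧ ∀ x : LinearMap.range (rieszProjection T z₀ ε : H →ₗ[ℂ] H),
        ∃ h : (x : H) ∈ T.domain, (N x : H) = T ⟨x, h⟩ - z₀ • (x : H) := by
  let V := LinearMap.range (rieszProjection T z₀ ε : H →ₗ[ℂ] H)
  have : FiniteDimensional ℂ V := hfin
  have hle : V ≤ T.domain := fun x hx => (range_rieszProjection_invariant hε hρ hfin hx).1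
  let N : Module.End ℂ V :=
    (T.toFun ∘ₗ Submodule.inclusion hle - z₀ • V.subtype).codRestrict V fun x =>
      V.sub_mem (range_rieszProjection_invariant hε hρ hfin x.2).2 (V.smul_mem _ x.2)
  refine ⟨N, isNilpotent_of_forall_hasEigenvalue fun μ hμ => ?_, fun x => ⟨hle x.2, rfl⟩⟩
  obtain ⟨x, hx⟩ := hμ.exists_hasEigenvector
  have hNx : T ⟨x, hle x.2⟩ - z₀ • (x : H) = μ • (x : H) := congrArg Subtype.val hx.apply_eq_smul
  have hTx : T ⟨x, hle x.2⟩ = (μ + z₀) • (x : H) := by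
    rw [add_smul, ← hNx, sub_add_cancel]
  simpa using eigenvalue_eq_of_mem_range_rieszProjection hε hρ hTx x.2 (by simpa using hx.2)

theorem exists_resolventOp_comp_recursion (hε : 0 < ε)
    (hρ : closedBall z₀ ε \ {z₀} ⊆ resSet T) (hfin : FiniteRank (rieszProjection T z₀ ε)) :
    ∃ (C : ℕ → H →L[ℂ] H) (n : ℕ), C 0 = rieszProjection T z₀ ε ∧ C n = 0 ∧
      (∀ k, (C k : H →ₗ[ℂ] H).HasFiniteRange) ∧ ∀ k, ∀ z ∈ resSet T,
        (z - z₀) • (resolventOp T z ∘L C k) = resolventOp T z ∘L C (k + 1) - C k := by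
  obtain ⟨N, ⟨n, hn⟩, hN⟩ := exists_isNilpotent_range_rieszProjection hε hρ hfin
  let V := LinearMap.range (rieszProjection T z₀ ε : H →ₗ[ℂ] H)
  have : FiniteDimensional ℂ V := hfin
  let Q : H →L[ℂ] V := (rieszProjection T z₀ ε).codRestrict V fun x => ⟨x, rfl⟩
  let C : ℕ → H →L[ℂ] H := fun k => V.subtypeL ∘L LinearMap.toContinuousLinearMap (N ^ k) ∘L Q
  refine ⟨C, n, rfl, ?_, fun k => ?_, fun k z hz => ?_⟩
  · ext x
    simp [C, hn]
  · exact LinearMap.HasFiniteRange.comp_left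
      (u := ((LinearMap.toContinuousLinearMap (N ^ k) ∘L Q : H →L[ℂ] V) : H →ₗ[ℂ] V))
      .of_isNoetherian_rng _
  · ext x
    let v : V := (N ^ k) (Q x)
    obtain ⟨h, hNv⟩ := hN v
    have hCx : C (k + 1) x = N v := by
      simp only [C, pow_succ', v]
      rfl
    have hRv := resolventOp_apply_sub hz ⟨v, h⟩
    have hTv : T ⟨v, h⟩ - z • (v : H) = N v - (z - z₀) • (v : H) := by
      rw [hNv]
      module
    rw [hTv, map_sub, map_smul, sub_eq_iff_eq_add, ← sub_eq_iff_eq_add'] at hRv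
    change (z - z₀) • resolventOp T z v = resolventOp T z (C (k + 1) x) - v
    rw [hCx, hRv]

theorem finMero_resolventOp_of_finiteRank (hε : 0 < ε) (hρ : closedBall z₀ ε \ {z₀} ⊆ resSet T)
    (hfin : FiniteRank (rieszProjection T z₀ ε)) : FinMero z₀ (resolventOp T) := by
  obtain ⟨C, n, hC0, hCn, hCfin, hC⟩ := exists_resolventOp_comp_recursion hε hρ hfin
  have hpole : ∀ k ≤ n, ∀ j : ℕ,
      FinMero z₀ fun z => ((z - z₀) ^ j)⁻¹ • (resolventOp T z ∘L C k) := by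
    intro k hk
    induction hk using Nat.decreasingInduction with
    | self =>
      intro j
      refine .congr (.analytic (analyticAt_const (v := 0))) (.of_forall fun z => ?_)
      simp [hCn]
    | of_succ k _ ih =>
      intro j
      refine .congr (.sub (ih (j + 1)) (.pole (j + 1) (hCfin k))) ?_
      filter_upwards [eventually_mem_ball_diff hε] with z hz
      rw [← smul_sub, ← hC k z (hρ ⟨ball_subset_closedBall hz.1, hz.2⟩), smul_smul, pow_succ,
        mul_inv, inv_mul_cancel_right₀ (sub_ne_zero.mpr hz.2)]
  refine .congr (.add (hpole 0 n.zero_le 0)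
    (.analytic (analyticAt_regularPart hε hρ (mem_ball_self hε)))) ?_
  filter_upwards [eventually_mem_ball_diff hε] with z hz
  rw [hC0, ← resolventOp_sub_comp_rieszProjection hε hρ hz, pow_zero, inv_one, one_smul,
    add_sub_cancel]

theorem sub_rieszProjection_apply (hε : 0 < ε) (hρ : closedBall z₀ ε \ {z₀} ⊆ resSet T)
    {x : T.domain} (hx : rieszProjection T z₀ ε (T x - z₀ • (x : H)) = T x - z₀ • (x : H)) {z : ℂ}
    (hz : z ∈ ball z₀ ε \ {z₀}) :
    (x : H) - rieszProjection T z₀ ε x = (z₀ - z) • regularPart T z₀ ε z x := by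
  have hzρ : z ∈ resSet T := hρ ⟨ball_subset_closedBall hz.1, hz.2⟩
  set P := rieszProjection T z₀ ε
  set R := resolventOp T z
  set y := T x - z₀ • (x : H) with hy
  have hPR : ∀ v, P (R v) = R (P v) := fun v =>
    (DFunLike.congr_fun (rieszProjection_comm hε hρ hzρ) v).symm
  have hTx : T x - z • (x : H) = y + (z₀ - z) • (x : H) := by
    rw [hy]
    module
  have hxR : (x : H) = R y + (z₀ - z) • R x := by
    rw [← map_smul, ← map_add, ← hTx, resolventOp_apply_sub hzρ]
  have hPx : P x = R y + (z₀ - z) • R (P x) := by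
    conv_lhs => rw [hxR, map_add, map_smul, hPR, hPR, hx]
  rw [← resolventOp_sub_comp_rieszProjection hε hρ hz]
  calc (x : H) - P x
      = (R y + (z₀ - z) • R x) - (R y + (z₀ - z) • R (P x)) := by rw [← hxR, ← hPx]
    _ = (z₀ - z) • (R x - R (P x)) := by module

theorem rieszProjection_apply_eq_self (hε : 0 < ε) (hρ : closedBall z₀ ε \ {z₀} ⊆ resSet T)
    {x : T.domain} (hx : rieszProjection T z₀ ε (T x - z₀ • (x : H)) = T x - z₀ • (x : H)) :
    rieszProjection T z₀ ε x = x := by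
  have hcont : ContinuousAt (fun z => (z₀ - z) • regularPart T z₀ ε z x) z₀ :=
    (continuousAt_const.sub continuousAt_id).smul
      ((analyticAt_regularPart hε hρ (mem_ball_self hε)).continuousAt.clm_apply
        continuousAt_const)
  have hlim : Tendsto (fun z => (z₀ - z) • regularPart T z₀ ε z x) (𝓝[≠] z₀) (𝓝 0) := by
    simpa using hcont.tendsto.mono_left nhdsWithin_le_nhds
  have hconst := hlim.congr' ((eventually_mem_ball_diff hε).mono fun z hz =>
    (sub_rieszProjection_apply hε hρ hx hz).symm)
  exact (sub_eq_zero.mp (tendsto_nhds_unique tendsto_const_nhds hconst)).symm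

theorem rieszProjection_apply_of_mem_kerPow (hε : 0 < ε)
    (hρ : closedBall z₀ ε \ {z₀} ⊆ resSet T) {n : ℕ} {x : H} (hx : x ∈ kerPow T z₀ n) :
    rieszProjection T z₀ ε x = x := by
  induction n generalizing x with
  | zero =>
    obtain rfl : x = 0 := hx
    exact map_zero _
  | succ n ih =>
    obtain ⟨h, hTx⟩ := mem_kerPow_succ.mp hx
    exact rieszProjection_apply_eq_self hε hρ (x := ⟨x, h⟩) (ih hTx)

theorem range_rieszProjection (hε : 0 < ε) (hρ : closedBall z₀ ε \ {z₀} ⊆ resSet T)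
    (hfin : FiniteRank (rieszProjection T z₀ ε)) :
    LinearMap.range (rieszProjection T z₀ ε : H →ₗ[ℂ] H) = algEigenspace T z₀ := by
  obtain ⟨N, ⟨n, hn⟩, hN⟩ := exists_isNilpotent_range_rieszProjection hε hρ hfin
  have hker : ∀ m (x : LinearMap.range (rieszProjection T z₀ ε : H →ₗ[ℂ] H)),
      (N ^ m) x = 0 → (x : H) ∈ kerPow T z₀ m := by
    intro m
    induction m with
    | zero =>
      rintro x rfl
      exact Submodule.zero_mem _
    | succ m ih =>
      intro x hx
      obtain ⟨h, hNx⟩ := hN x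
      exact mem_kerPow_succ.mpr ⟨h, hNx ▸ ih (N x) (by rwa [pow_succ] at hx)⟩
  refine le_antisymm (fun x hx => ?_) (iSup_le fun m x hx => ?_)
  · exact le_iSup (kerPow T z₀) n (hker n ⟨x, hx⟩ (by rw [hn, LinearMap.zero_apply]))
  · exact ⟨x, rieszProjection_apply_of_mem_kerPow hε hρ hx⟩

theorem finiteRankTrace_rieszProjection (hε : 0 < ε) (hρ : closedBall z₀ ε \ {z₀} ⊆ resSet T)
    (hfin : FiniteRank (rieszProjection T z₀ ε)) :
    finiteRankTrace (rieszProjection T z₀ ε) = algMult T z₀ := by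
  rw [algMult, ← range_rieszProjection hε hρ hfin, finiteRankTrace]
  unfold FiniteRank at hfin
  rw [← LinearMap.trace_id]
  congr 1
  ext x
  exact rieszProjection_apply_of_mem_range hε hρ x.2

theorem IsIsolatingDisc.finMero_resolventOp (h : IsIsolatingDisc T z₀ r) :
    FinMero z₀ (resolventOp T) :=
  finMero_resolventOp_of_finiteRank (half_pos h.pos)
    (h.closedBall_diff_subset (half_lt_self h.pos))
    (h.finiteRank _ ⟨half_pos h.pos, half_lt_self h.pos⟩)

theorem IsIsolatingDisc.finiteRankTrace_eq_algMult (h : IsIsolatingDisc T z₀ r)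
    (hε : ε ∈ Set.Ioo 0 r) :
    finiteRankTrace (rieszProjection T z₀ ε) = algMult T z₀ :=
  finiteRankTrace_rieszProjection hε.1 (h.closedBall_diff_subset hε.2) (h.finiteRank ε hε)

theorem rieszProjection_eq_zero (hε : 0 ≤ ε) (hρ : closedBall z₀ ε ⊆ resSet T) :
    rieszProjection T z₀ ε = 0 := by
  rw [rieszProjection, circleIntegral_eq_zero_of_differentiableOn hε fun z hz =>
    (analyticAt_resolventOp (hρ hz)).differentiableAt.differentiableWithinAt, smul_zero, neg_zero]

theorem eventually_isIsolatingDisc (h : z₀ ∈ discreteSpectrum T ∪ resSet T) :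
    ∀ᶠ r in 𝓝[>] (0 : ℝ), IsIsolatingDisc T z₀ r := by
  suffices ∃ r, IsIsolatingDisc T z₀ r by
    obtain ⟨r, hr⟩ := this
    filter_upwards [Ioc_mem_nhdsGT hr.pos] with δ hδ using hr.mono hδ.1 hδ.2
  rcases h with ⟨-, r, hr, hρ, hfin⟩ | h
  · exact ⟨r, hr, hρ, fun ε hε => hfin ε hε.1 hε.2⟩
  · obtain ⟨r, hr, hρ⟩ := isOpen_iff.mp isOpen_resSet z₀ h
    refine ⟨r, hr, fun z hz => hρ hz.1, fun ε hε => ?_⟩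
    rw [rieszProjection_eq_zero hε.1.le ((closedBall_subset_ball hε.2).trans hρ)]
    exact finiteRank_zero

end Riesz

section HilbertSpace

variable {X Y : Type*} [NormedAddCommGroup X] [InnerProductSpace ℂ X] [CompleteSpace X]
  [NormedAddCommGroup Y] [InnerProductSpace ℂ Y] [CompleteSpace Y]

theorem continuous_of_formalAdjoint (f : X →ₗ[ℂ] Y) (g : Y → X)
    (h : ∀ x y, inner ℂ (f x) y = inner ℂ x (g y)) : Continuous f := by
  refine f.continuous_of_seq_closed_graph fun u x y hu hfu => ?_
  refine ext_inner_right ℂ fun v => ?_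
  have hfuv : Tendsto (fun n => inner ℂ (f (u n)) v) atTop (𝓝 (inner ℂ y v)) :=
    hfu.inner tendsto_const_nhds
  have huv : Tendsto (fun n => inner ℂ (u n) (g v)) atTop (𝓝 (inner ℂ x (g v))) :=
    hu.inner tendsto_const_nhds
  rw [h x v]
  exact tendsto_nhds_unique (hfuv.congr fun n => h (u n) v) huv

theorem hasRightInverse_of_surjective {A : X →L[ℂ] Y} (hA : Function.Surjective A) :
    A.HasRightInverse := by
  let N := LinearMap.ker (A : X →ₗ[ℂ] Y)
  have : CompleteSpace N := A.isClosed_ker.completeSpace_coe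
  let L : Nᗮ →L[ℂ] Y := A ∘L Nᗮ.subtypeL
  have hker : L.ker = ⊥ := by
    refine LinearMap.ker_eq_bot'.mpr fun x hx => Subtype.ext ?_
    have hxN : (x : X) ∈ N ⊓ Nᗮ := ⟨hx, x.2⟩
    rwa [Submodule.inf_orthogonal_eq_bot] at hxN
  have hran : L.range = ⊤ := by
    refine LinearMap.range_eq_top.mpr fun y => ?_
    obtain ⟨x, rfl⟩ := hA y
    obtain ⟨a, ha, c, hc, rfl⟩ := N.exists_add_mem_mem_orthogonal x
    have hAa : A a = 0 := ha
    exact ⟨⟨c, hc⟩, by simp [L, hAa]⟩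
  let e := ContinuousLinearEquiv.ofBijective L hker hran
  exact ⟨Nᗮ.subtypeL ∘L (e.symm : Y →L[ℂ] Nᗮ), e.apply_symm_apply⟩

theorem hasLeftInverse_adjoint {A : X →L[ℂ] Y} (hA : A.HasRightInverse) :
    A.adjoint.HasLeftInverse := by
  obtain ⟨Q, hQ⟩ := hA
  refine ⟨Q.adjoint, fun y => ext_inner_right ℂ fun v => ?_⟩
  rw [ContinuousLinearMap.adjoint_inner_left, ContinuousLinearMap.adjoint_inner_left, hQ]

variable {A : X →ₗ.[ℂ] X}

theorem exists_adjoint_apply (hA : Dense (A.domain : Set X)) {x y : X}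
    (h : ∀ u : A.domain, inner ℂ y (u : X) = inner ℂ x (A u)) :
    ∃ hx : x ∈ A.adjoint.domain, A.adjoint ⟨x, hx⟩ = y :=
  ⟨LinearPMap.mem_adjoint_domain_of_exists _ ⟨y, h⟩, LinearPMap.adjoint_apply_eq hA _ h⟩

theorem isSelfAdjoint_of_isFormalAdjoint (hA : Dense (A.domain : Set X))
    (hsymm : A.IsFormalAdjoint A) (h : A.adjoint.domain ≤ A.domain) : IsSelfAdjoint A := by
  have hle := hsymm.le_adjoint hA
  exact (LinearPMap.eq_of_le_of_domain_eq hle (le_antisymm hle.1 h)).symm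

theorem isFormalAdjoint_of_isSelfAdjoint (hA : IsSelfAdjoint A) : A.IsFormalAdjoint A := by
  have h := LinearPMap.adjoint_isFormalAdjoint hA.dense_domain
  rwa [LinearPMap.isSelfAdjoint_def.mp hA] at h

theorem conj_mem_resSet (hA : IsSelfAdjoint A) {z : ℂ} (hz : z ∈ resSet A) :
    starRingEnd ℂ z ∈ resSet A := by
  let R := resolventOp A z
  refine ⟨R.adjoint, fun y => ?_, fun x => ext_inner_right ℂ fun y => ?_⟩
  · have hadj : ∀ u : A.domain,
        inner ℂ (y + starRingEnd ℂ z • R.adjoint y) (u : X) = inner ℂ (R.adjoint y) (A u) := by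
      intro u
      have hy : inner ℂ (R.adjoint y) (A u - z • (u : X)) = inner ℂ y (u : X) := by
        rw [ContinuousLinearMap.adjoint_inner_left, resolventOp_apply_sub hz]
      rw [inner_sub_right, inner_smul_right, sub_eq_iff_eq_add] at hy
      rw [hy, inner_add_left, inner_smul_left, Complex.conj_conj]
    have hmem := exists_adjoint_apply hA.dense_domain hadj
    rw [LinearPMap.isSelfAdjoint_def.mp hA] at hmem
    exact hmem.imp fun _ => sub_eq_iff_eq_add.mpr
  · change inner ℂ (R.adjoint (A x - starRingEnd ℂ z • (x : X))) y = inner ℂ (x : X) y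
    obtain ⟨hy, hARy⟩ := resolventOp_mem hz y
    rw [ContinuousLinearMap.adjoint_inner_left, inner_sub_left, inner_smul_left,
      Complex.conj_conj, isFormalAdjoint_of_isSelfAdjoint hA x ⟨_, hy⟩, hARy, inner_add_right,
      inner_smul_right, add_sub_cancel_right]

end HilbertSpace

namespace BoundaryTriple

variable {H : Type*} [NormedAddCommGroup H] [InnerProductSpace ℂ H] [CompleteSpace H]
  {S : H →ₗ.[ℂ] H} {G : Type*} [NormedAddCommGroup G] [InnerProductSpace ℂ G]
  (b : BoundaryTriple S G)

theorem exists_kerExtension_apply {f : S.adjoint.domain} (hf : b.Γ₀ f = 0) :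
    ∃ h : (f : H) ∈ b.kerExtension.domain, b.kerExtension ⟨f, h⟩ = S.adjoint f :=
  ⟨⟨⟨f, hf, rfl⟩, f.2⟩, LinearPMap.domRestrict_apply rfl⟩

theorem exists_lift_kerExtension (x : b.kerExtension.domain) :
    ∃ f : S.adjoint.domain, (f : H) = x ∧ b.Γ₀ f = 0 ∧ S.adjoint f = b.kerExtension x := by
  obtain ⟨x, ⟨f, hf, hfx⟩, -⟩ := x
  exact ⟨f, hfx, hf, (LinearPMap.domRestrict_apply hfx.symm).symm⟩

theorem exists_extension_apply {Θ : G →ₗ.[ℂ] G} {f : S.adjoint.domain}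
    (hf : (b.Γ₀ f, b.Γ₁ f) ∈ Θ.graph) :
    ∃ h : (f : H) ∈ (b.extension Θ).domain, b.extension Θ ⟨f, h⟩ = S.adjoint f :=
  ⟨⟨⟨f, hf, rfl⟩, f.2⟩, LinearPMap.domRestrict_apply rfl⟩

theorem exists_lift_extension {Θ : G →ₗ.[ℂ] G} (x : (b.extension Θ).domain) :
    ∃ f : S.adjoint.domain, (f : H) = x ∧ (b.Γ₀ f, b.Γ₁ f) ∈ Θ.graph ∧
      S.adjoint f = b.extension Θ x := by
  obtain ⟨x, ⟨f, hf, hfx⟩, -⟩ := x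
  exact ⟨f, hfx, hf, (LinearPMap.domRestrict_apply hfx.symm).symm⟩

theorem exists_boundary_eq (φ ψ : G) : ∃ f : S.adjoint.domain, b.Γ₀ f = φ ∧ b.Γ₁ f = ψ :=
  (b.surjective (φ, ψ)).imp fun _ => Prod.ext_iff.mp

section SelfAdjoint

variable {b}

theorem boundary_eq_zero_of_green {f : S.adjoint.domain}
    (h : ∀ g : S.adjoint.domain, inner ℂ (g : H) (S.adjoint f) = inner ℂ (S.adjoint g) (f : H)) :
    b.Γ₀ f = 0 ∧ b.Γ₁ f = 0 := by
  have hgreen := fun g => (b.green f g).symm.trans (sub_eq_zero.mpr (h g))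
  obtain ⟨g₀, hg₀, hg₀'⟩ := b.exists_boundary_eq (b.Γ₁ f) 0
  obtain ⟨g₁, hg₁, hg₁'⟩ := b.exists_boundary_eq 0 (b.Γ₀ f)
  have h₁ := hgreen g₀
  have h₀ := hgreen g₁
  rw [hg₀, hg₀', inner_zero_left, sub_zero, inner_self_eq_zero] at h₁
  rw [hg₁, hg₁', inner_zero_left, zero_sub, neg_eq_zero, inner_self_eq_zero] at h₀
  exact ⟨h₀, h₁⟩

theorem le_kerExtension (hS : Dense (S.domain : Set H)) (hsymm : S.IsFormalAdjoint S) :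
    S ≤ b.kerExtension := by
  have hle := hsymm.le_adjoint hS
  have happly : ∀ u : S.domain, S.adjoint ⟨u, hle.1 u.2⟩ = S u := fun u => (hle.2 rfl).symm
  have hΓ₀ : ∀ u : S.domain, b.Γ₀ ⟨u, hle.1 u.2⟩ = 0 := fun u =>
    (boundary_eq_zero_of_green fun g => by
      rw [happly, LinearPMap.adjoint_isFormalAdjoint hS]).1
  refine ⟨fun u hu => (b.exists_kerExtension_apply (hΓ₀ ⟨u, hu⟩)).1, fun u x hux => ?_⟩
  obtain ⟨f, hfx, -, hf⟩ := b.exists_lift_kerExtension x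
  rw [← hf, ← happly]
  exact congrArg _ (Subtype.ext (hux.trans hfx.symm))

theorem isFormalAdjoint_kerExtension : b.kerExtension.IsFormalAdjoint b.kerExtension := by
  intro x y
  obtain ⟨f, hfx, hf₀, hf⟩ := b.exists_lift_kerExtension x
  obtain ⟨g, hgy, hg₀, hg⟩ := b.exists_lift_kerExtension y
  have hgreen := b.green g f
  rw [hf₀, hg₀, inner_zero_left, inner_zero_right, sub_zero, sub_eq_zero] at hgreen
  rw [← hf, ← hg, ← hfx, ← hgy, hgreen]

theorem isSelfAdjoint_kerExtension (hS : Dense (S.domain : Set H))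
    (hsymm : S.IsFormalAdjoint S) : IsSelfAdjoint b.kerExtension := by
  have hle : S ≤ b.kerExtension := le_kerExtension hS hsymm
  have hdense : Dense (b.kerExtension.domain : Set H) := hS.mono hle.1
  refine isSelfAdjoint_of_isFormalAdjoint hdense isFormalAdjoint_kerExtension fun x hx => ?_
  let y := b.kerExtension.adjoint ⟨x, hx⟩
  have hadj : ∀ u : b.kerExtension.domain, inner ℂ y (u : H) = inner ℂ x (b.kerExtension u) :=
    LinearPMap.adjoint_isFormalAdjoint hdense ⟨x, hx⟩
  obtain ⟨hxS, hy⟩ : ∃ h : x ∈ S.adjoint.domain, S.adjoint ⟨x, h⟩ = y :=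
    exists_adjoint_apply hS fun u => by
      rw [hle.2 (y := ⟨u, hle.1 u.2⟩) rfl]
      exact hadj ⟨u, hle.1 u.2⟩
  obtain ⟨f, hf₀, hf₁⟩ := b.exists_boundary_eq 0 (b.Γ₀ ⟨x, hxS⟩)
  obtain ⟨hf, hAf⟩ := b.exists_kerExtension_apply hf₀
  have hgreen := b.green f ⟨x, hxS⟩
  rw [hf₀, hf₁, hy, inner_zero_right, sub_zero, ← hAf, ← hadj ⟨f, hf⟩, sub_self, eq_comm,
    inner_self_eq_zero] at hgreen
  exact (b.exists_kerExtension_apply hgreen).1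

end SelfAdjoint

end BoundaryTriple

/-- The operator `(T - w) (T - z)⁻¹`. It carries the `γ`-field at `w` to the `γ`-field at `z`. -/
noncomputable def transferOp {H : Type*} [NormedAddCommGroup H] [InnerProductSpace ℂ H]
    (T : H →ₗ.[ℂ] H) (z w : ℂ) : H →L[ℂ] H :=
  1 + (z - w) • resolventOp T z

namespace BoundaryTriple

variable {H : Type*} [NormedAddCommGroup H] [InnerProductSpace ℂ H] [CompleteSpace H]
  {S : H →ₗ.[ℂ] H} {G : Type*} [NormedAddCommGroup G] [InnerProductSpace ℂ G]
  {b : BoundaryTriple S G} {Θ : G →ₗ.[ℂ] G} {z w : ℂ}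

section Weyl

theorem exists_lift_resolventOp (hz : z ∈ resSet b.kerExtension) (h : H) :
    ∃ f : S.adjoint.domain, (f : H) = resolventOp b.kerExtension z h ∧ b.Γ₀ f = 0 ∧
      S.adjoint f = h + z • (f : H) := by
  obtain ⟨hmem, happly⟩ := resolventOp_mem hz h
  obtain ⟨f, hf, hf₀, hSf⟩ := b.exists_lift_kerExtension ⟨_, hmem⟩
  exact ⟨f, hf, hf₀, by rw [hSf, happly, hf]⟩

theorem resolventOp_adjoint_sub (hz : z ∈ resSet b.kerExtension) {f : S.adjoint.domain}
    (hf : b.Γ₀ f = 0) : resolventOp b.kerExtension z (S.adjoint f - z • (f : H)) = f := by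
  obtain ⟨hmem, happly⟩ := b.exists_kerExtension_apply hf
  have hR := resolventOp_apply_sub hz ⟨f, hmem⟩
  rwa [happly] at hR

theorem mem_defect {f : S.adjoint.domain} : f ∈ defect S z ↔ S.adjoint f = z • (f : H) :=
  sub_eq_zero

theorem bijective_domRestrict_defect (hz : z ∈ resSet b.kerExtension) :
    Function.Bijective (b.Γ₀.domRestrict (defect S z)) := by
  constructor
  · refine (injective_iff_map_eq_zero _).mpr fun ⟨f, hf⟩ hf₀ => ?_
    have hRf := resolventOp_adjoint_sub hz (f := f) hf₀
    rw [mem_defect.mp hf, sub_self, map_zero] at hRf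
    exact Subtype.ext (Subtype.ext hRf.symm)
  · intro φ
    obtain ⟨f, rfl, -⟩ := b.exists_boundary_eq φ 0
    obtain ⟨v, -, hv₀, hSv⟩ := exists_lift_resolventOp hz (S.adjoint f - z • (f : H))
    refine ⟨⟨f - v, mem_defect.mpr ?_⟩, ?_⟩
    · rw [LinearPMap.map_sub, hSv, Submodule.coe_sub]
      module
    · change b.Γ₀ (f - v) = b.Γ₀ f
      rw [map_sub, hv₀, sub_zero]

theorem gammaField_spec (hz : z ∈ resSet b.kerExtension) (φ : G) :
    b.Γ₀ (b.gammaField z φ) = φ ∧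
      S.adjoint (b.gammaField z φ) = z • (b.gammaField z φ : H) := by
  have hbij := bijective_domRestrict_defect hz
  rw [gammaField, dif_pos hbij]
  exact ⟨(LinearEquiv.ofBijective _ hbij).apply_symm_apply φ,
    mem_defect.mp ((LinearEquiv.ofBijective _ hbij).symm φ).2⟩

theorem gammaField_eq (hz : z ∈ resSet b.kerExtension) {f : S.adjoint.domain}
    (hf : S.adjoint f = z • (f : H)) : b.gammaField z (b.Γ₀ f) = f := by
  obtain ⟨hΓ₀, hS⟩ := gammaField_spec hz (b.Γ₀ f)
  exact congrArg Subtype.val <| (bijective_domRestrict_defect hz).1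
    (a₁ := ⟨b.gammaField z (b.Γ₀ f), mem_defect.mpr hS⟩) (a₂ := ⟨f, mem_defect.mpr hf⟩) hΓ₀

theorem inner_gammaField (hz : starRingEnd ℂ z ∈ resSet b.kerExtension) {h : H}
    {f : S.adjoint.domain} (hf₀ : b.Γ₀ f = 0) (hf : S.adjoint f = h + z • (f : H)) (φ : G) :
    inner ℂ (b.gammaField (starRingEnd ℂ z) φ : H) h = inner ℂ φ (b.Γ₁ f) := by
  obtain ⟨hΓ₀, hS⟩ := gammaField_spec hz φ
  have hgreen := b.green f (b.gammaField (starRingEnd ℂ z) φ)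
  rwa [hΓ₀, hS, hf₀, hf, inner_zero_right, sub_zero, inner_add_right, inner_smul_left,
    inner_smul_right, Complex.conj_conj, add_sub_cancel_right] at hgreen

theorem inner_weyl (hz : z ∈ resSet b.kerExtension)
    (hz' : starRingEnd ℂ z ∈ resSet b.kerExtension) (φ ψ : G) :
    inner ℂ (b.weyl z φ) ψ = inner ℂ φ (b.weyl (starRingEnd ℂ z) ψ) := by
  obtain ⟨hφ, hSφ⟩ := gammaField_spec hz φ
  obtain ⟨hψ, hSψ⟩ := gammaField_spec hz' ψ
  have hgreen := b.green (b.gammaField (starRingEnd ℂ z) ψ) (b.gammaField z φ)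
  rw [hφ, hSφ, hψ, hSψ, inner_smul_left, inner_smul_right, sub_self] at hgreen
  exact (sub_eq_zero.mp hgreen.symm).symm

theorem gammaField_eq_add_smul (hz : z ∈ resSet b.kerExtension) (hw : w ∈ resSet b.kerExtension)
    (φ : G) {v : S.adjoint.domain}
    (hv : (v : H) = resolventOp b.kerExtension z (b.gammaField w φ)) :
    b.gammaField z φ = b.gammaField w φ + (z - w) • v := by
  obtain ⟨hφ, hSφ⟩ := gammaField_spec hw φ
  obtain ⟨u, hu, hu₀, hSu⟩ := exists_lift_resolventOp hz (b.gammaField w φ : H)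
  obtain rfl : v = u := Subtype.ext (hv.trans hu.symm)
  have hdefect : S.adjoint (b.gammaField w φ + (z - w) • v) =
      z • ((b.gammaField w φ + (z - w) • v : S.adjoint.domain) : H) := by
    rw [LinearPMap.map_add, LinearPMap.map_smul, hSφ, hSu, Submodule.coe_add, Submodule.coe_smul]
    module
  simpa only [map_add, map_smul, hu₀, smul_zero, add_zero, hφ] using gammaField_eq hz hdefect

theorem eq_zero_of_apply_eq_weyl (hz : z ∈ resSet b.kerExtension)
    (hzΘ : z ∈ resSet (b.extension Θ)) {φ : Θ.domain} (hφ : Θ φ = b.weyl z φ) : φ = 0 := by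
  obtain ⟨hΓ₀, hS⟩ := gammaField_spec hz (φ : G)
  obtain ⟨hmem, happly⟩ := b.exists_extension_apply (f := b.gammaField z φ)
    ((LinearPMap.mem_graph_iff Θ).mpr ⟨φ, hΓ₀.symm, hφ⟩)
  have hR := resolventOp_apply_sub hzΘ ⟨_, hmem⟩
  rw [happly, hS, sub_self, map_zero] at hR
  have hγ : b.gammaField z φ = 0 := Subtype.ext hR.symm
  rw [hγ, map_zero] at hΓ₀
  exact Subtype.ext hΓ₀.symm

end Weyl

section Bounded

variable [CompleteSpace G]

theorem continuous_gammaField (hA : IsSelfAdjoint b.kerExtension)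
    (hz : z ∈ resSet b.kerExtension) :
    Continuous (S.adjoint.domain.subtype ∘ₗ b.gammaField z) := by
  choose f _ hf₀ hSf using exists_lift_resolventOp (conj_mem_resSet hA hz)
  refine continuous_of_formalAdjoint _ (fun h => b.Γ₁ (f h)) fun φ h => ?_
  simpa using inner_gammaField (by rwa [Complex.conj_conj]) (hf₀ h) (hSf h) φ

theorem continuous_weyl (hA : IsSelfAdjoint b.kerExtension) (hz : z ∈ resSet b.kerExtension) :
    Continuous (b.weyl z) :=
  continuous_of_formalAdjoint _ _ (inner_weyl hz (conj_mem_resSet hA hz))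

open Classical in
/-- The `γ`-field `γ(z)` as a bounded operator into `H`; `0` where it is not bounded. -/
noncomputable def gammaCLM (b : BoundaryTriple S G) (z : ℂ) : G →L[ℂ] H :=
  if h : Continuous (S.adjoint.domain.subtype ∘ₗ b.gammaField z) then ⟨_, h⟩ else 0

open Classical in
/-- The Weyl function `M(z)` as a bounded operator; `0` where it is not bounded. -/
noncomputable def weylCLM (b : BoundaryTriple S G) (z : ℂ) : G →L[ℂ] G :=
  if h : Continuous (b.weyl z) then ⟨_, h⟩ else 0

/-- The operator `γ(z̄)* = Γ₁ (A₀ - z)⁻¹`. -/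
noncomputable def gammaAdjoint (b : BoundaryTriple S G) (z : ℂ) : H →L[ℂ] G :=
  (b.gammaCLM (starRingEnd ℂ z)).adjoint

theorem gammaCLM_apply (hA : IsSelfAdjoint b.kerExtension) (hz : z ∈ resSet b.kerExtension)
    (φ : G) : b.gammaCLM z φ = b.gammaField z φ := by
  rw [gammaCLM, dif_pos (continuous_gammaField hA hz)]
  rfl

theorem weylCLM_apply (hA : IsSelfAdjoint b.kerExtension) (hz : z ∈ resSet b.kerExtension)
    (φ : G) : b.weylCLM z φ = b.weyl z φ := by
  rw [weylCLM, dif_pos (continuous_weyl hA hz)]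
  rfl

theorem gammaAdjoint_apply (hA : IsSelfAdjoint b.kerExtension) (hz : z ∈ resSet b.kerExtension)
    {h : H} {f : S.adjoint.domain} (hf : (f : H) = resolventOp b.kerExtension z h) :
    b.gammaAdjoint z h = b.Γ₁ f := by
  obtain ⟨u, hu, hu₀, hSu⟩ := exists_lift_resolventOp hz h
  obtain rfl : f = u := Subtype.ext (hf.trans hu.symm)
  have hz' := conj_mem_resSet hA hz
  refine ext_inner_left ℂ fun φ => ?_
  rw [gammaAdjoint, ContinuousLinearMap.adjoint_inner_right, gammaCLM_apply hA hz',
    inner_gammaField hz' hu₀ hSu]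

theorem gammaCLM_eq_comp (hA : IsSelfAdjoint b.kerExtension) (hz : z ∈ resSet b.kerExtension)
    (hw : w ∈ resSet b.kerExtension) :
    b.gammaCLM z = transferOp b.kerExtension z w ∘L b.gammaCLM w := by
  ext φ
  obtain ⟨v, hv, -⟩ := exists_lift_resolventOp hz (b.gammaField w φ : H)
  rw [gammaCLM_apply hA hz, gammaField_eq_add_smul hz hw φ hv, Submodule.coe_add,
    Submodule.coe_smul, hv]
  simp [transferOp, gammaCLM_apply hA hw]

theorem gammaAdjoint_eq_comp (hA : IsSelfAdjoint b.kerExtension) (hz : z ∈ resSet b.kerExtension)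
    (hw : w ∈ resSet b.kerExtension) :
    b.gammaAdjoint z = b.gammaAdjoint w ∘L transferOp b.kerExtension z w := by
  have hR : resolventOp b.kerExtension z =
      resolventOp b.kerExtension w ∘L transferOp b.kerExtension z w := by
    rw [transferOp, ContinuousLinearMap.comp_add, ContinuousLinearMap.comp_smul,
      ← resolventOp_comm hz hw, ← resolventOp_sub hz hw]
    exact (add_sub_cancel _ _).symm
  ext h
  obtain ⟨f, hf, -⟩ := exists_lift_resolventOp hz h
  rw [gammaAdjoint_apply hA hz hf]
  exact (gammaAdjoint_apply hA hw (hf.trans (DFunLike.congr_fun hR h))).symm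

theorem weylCLM_sub (hA : IsSelfAdjoint b.kerExtension) (hz : z ∈ resSet b.kerExtension)
    (hw : w ∈ resSet b.kerExtension) :
    b.weylCLM w - b.weylCLM z = (w - z) • (b.gammaAdjoint z ∘L b.gammaCLM w) := by
  ext φ
  obtain ⟨v, hv, -⟩ := exists_lift_resolventOp hz (b.gammaField w φ : H)
  have hweyl : b.weyl z φ = b.weyl w φ + (z - w) • b.Γ₁ v := by
    rw [weyl, LinearMap.comp_apply, gammaField_eq_add_smul hz hw φ hv, map_add, map_smul]
    rfl
  rw [sub_apply, smul_apply, ContinuousLinearMap.comp_apply, weylCLM_apply hA hz,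
    weylCLM_apply hA hw, gammaCLM_apply hA hw, gammaAdjoint_apply hA hz hv, hweyl]
  module

theorem hasRightInverse_gammaAdjoint (hA : IsSelfAdjoint b.kerExtension)
    (hz : z ∈ resSet b.kerExtension) : (b.gammaAdjoint z).HasRightInverse := by
  refine hasRightInverse_of_surjective fun ψ => ?_
  obtain ⟨f, hf₀, rfl⟩ := b.exists_boundary_eq 0 ψ
  exact ⟨_, gammaAdjoint_apply hA hz (resolventOp_adjoint_sub hz hf₀).symm⟩

theorem hasLeftInverse_gammaCLM (hA : IsSelfAdjoint b.kerExtension)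
    (hz : z ∈ resSet b.kerExtension) : (b.gammaCLM z).HasLeftInverse := by
  have h := hasLeftInverse_adjoint (hasRightInverse_gammaAdjoint hA (conj_mem_resSet hA hz))
  rwa [gammaAdjoint, Complex.conj_conj, ContinuousLinearMap.adjoint_adjoint] at h

end Bounded

section Krein

/-- The family of operators `z ↦ Θ - M(z)`. -/
noncomputable abbrev weylDiff (b : BoundaryTriple S G) (Θ : G →ₗ.[ℂ] G) (z : ℂ) : G →ₗ.[ℂ] G :=
  subMap Θ (b.weyl z)

/-- The inverse of `Θ - M(z)`, with one-sided inverses `P` of `γ(w)` and `Q` of `γ(w̄)*` at a fixed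
point `w`, so that its dependence on `z` is visible. -/
noncomputable def weylInv (b : BoundaryTriple S G) (Θ : G →ₗ.[ℂ] G) (w : ℂ) (P : H →L[ℂ] G)
    (Q : G →L[ℂ] H) (z : ℂ) : G →L[ℂ] G :=
  (P ∘L transferOp b.kerExtension w z) ∘L
    (resolventOp (b.extension Θ) z - resolventOp b.kerExtension z) ∘L
      transferOp b.kerExtension w z ∘L Q

variable [CompleteSpace G]

theorem exists_resolventOp_sub_eq (hA : IsSelfAdjoint b.kerExtension)
    (hz : z ∈ resSet b.kerExtension) (hzΘ : z ∈ resSet (b.extension Θ)) (h : H) :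
    ∃ φ : Θ.domain, b.weylDiff Θ z φ = b.gammaAdjoint z h ∧
      resolventOp (b.extension Θ) z h - resolventOp b.kerExtension z h = b.gammaCLM z φ := by
  obtain ⟨v, hv, hv₀, hSv⟩ := exists_lift_resolventOp hz h
  obtain ⟨hmem, happly⟩ := resolventOp_mem hzΘ h
  obtain ⟨u, hu, huΘ, hSu⟩ := b.exists_lift_extension ⟨_, hmem⟩
  obtain ⟨φ, hφ, hΘφ⟩ := (LinearPMap.mem_graph_iff Θ).mp huΘ
  have hdefect : S.adjoint (u - v) = z • ((u - v : S.adjoint.domain) : H) := by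
    rw [LinearPMap.map_sub, hSu, happly, hSv, Submodule.coe_sub, hu]
    module
  have hγ : b.gammaField z φ = u - v := by
    simpa only [map_sub, hv₀, sub_zero, hφ] using gammaField_eq hz hdefect
  refine ⟨φ, ?_, ?_⟩
  · change Θ φ - b.Γ₁ (b.gammaField z φ) = _
    rw [hγ, map_sub, gammaAdjoint_apply hA hz hv, hΘφ, sub_sub_cancel]
  · rw [gammaCLM_apply hA hz, hγ, Submodule.coe_sub, hu, hv]

theorem exists_weylInv_eq (hA : IsSelfAdjoint b.kerExtension) (hw : w ∈ resSet b.kerExtension)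
    {P : H →L[ℂ] G} {Q : G →L[ℂ] H} (hP : Function.LeftInverse P (b.gammaCLM w))
    (hQ : Function.RightInverse Q (b.gammaAdjoint w)) (hz : z ∈ resSet b.kerExtension)
    (hzΘ : z ∈ resSet (b.extension Θ)) (ψ : G) :
    ∃ φ : Θ.domain, b.weylInv Θ w P Q z ψ = φ ∧ b.weylDiff Θ z φ = ψ := by
  let U := transferOp b.kerExtension w z
  obtain ⟨φ, hφ, hR⟩ := exists_resolventOp_sub_eq hA hz hzΘ (U (Q ψ))
  refine ⟨φ, ?_, ?_⟩
  · calc b.weylInv Θ w P Q z ψ = P (U (b.gammaCLM z φ)) := by rw [← hR]; rfl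
      _ = P (b.gammaCLM w φ) := by rw [gammaCLM_eq_comp hA hw hz]; rfl
      _ = φ := hP _
  · calc b.weylDiff Θ z φ = b.gammaAdjoint z (U (Q ψ)) := hφ
      _ = b.gammaAdjoint w (Q ψ) := by rw [gammaAdjoint_eq_comp hA hw hz]; rfl
      _ = ψ := hQ ψ

theorem isBoundedInverse_weylInv (hA : IsSelfAdjoint b.kerExtension)
    (hw : w ∈ resSet b.kerExtension) {P : H →L[ℂ] G} {Q : G →L[ℂ] H}
    (hP : Function.LeftInverse P (b.gammaCLM w))
    (hQ : Function.RightInverse Q (b.gammaAdjoint w))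
    (hz : z ∈ resSet b.kerExtension) (hzΘ : z ∈ resSet (b.extension Θ)) :
    IsBoundedInverse (b.weylDiff Θ z) (b.weylInv Θ w P Q z) := by
  have hinv := exists_weylInv_eq hA hw hP hQ hz hzΘ
  refine ⟨fun ψ => ?_, fun (x : Θ.domain) => ?_⟩
  · obtain ⟨φ, hφ, hψ⟩ := hinv ψ
    rw [hφ]
    exact ⟨φ.2, hψ⟩
  · obtain ⟨φ, hφ, hφx⟩ := hinv (b.weylDiff Θ z x)
    have hsub : φ - x = 0 := by
      refine eq_zero_of_apply_eq_weyl hz hzΘ ?_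
      rw [LinearPMap.map_sub, Submodule.coe_sub, map_sub, sub_eq_sub_iff_sub_eq_sub]
      exact hφx
    rw [hφ, sub_eq_zero.mp hsub]

theorem boundedlyInvertible_weylDiff (hA : IsSelfAdjoint b.kerExtension)
    (hz : z ∈ resSet b.kerExtension) (hzΘ : z ∈ resSet (b.extension Θ)) :
    BoundedlyInvertible (b.weylDiff Θ z) := by
  obtain ⟨P, hP⟩ := hasLeftInverse_gammaCLM hA hz
  obtain ⟨Q, hQ⟩ := hasRightInverse_gammaAdjoint hA hz
  exact ⟨_, isBoundedInverse_weylInv hA hz hP hQ hz hzΘ⟩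

theorem krein_formula (hA : IsSelfAdjoint b.kerExtension) (hz : z ∈ resSet b.kerExtension)
    (hzΘ : z ∈ resSet (b.extension Θ)) :
    resolventOp (b.extension Θ) z - resolventOp b.kerExtension z =
      (b.gammaCLM z ∘L boundedInverse (b.weylDiff Θ z)) ∘L b.gammaAdjoint z := by
  ext h
  obtain ⟨φ, hφ, hR⟩ := exists_resolventOp_sub_eq hA hz hzΘ h
  have hinv := (isBoundedInverse_boundedInverse (boundedlyInvertible_weylDiff hA hz hzΘ)).2 φ
  rw [sub_apply, hR, ContinuousLinearMap.comp_apply, ContinuousLinearMap.comp_apply, ← hφ, hinv]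

end Krein

end BoundaryTriple

theorem finitelyMeromorphicOn_ball {G : Type*} [NormedAddCommGroup G] [InnerProductSpace ℂ G]
    {f : ℂ → G →L[ℂ] G} {z₀ : ℂ} {r : ℝ} (hf : FinMero z₀ f)
    (ha : AnalyticOnNhd ℂ f (ball z₀ r \ {z₀})) : FinitelyMeromorphicOn f (ball z₀ r) := by
  intro z hz
  rcases eq_or_ne z z₀ with rfl | hne
  · exact hf.finitelyMeromorphicAt
  · exact (FinMero.analytic (ha z ⟨hz, hne⟩)).finitelyMeromorphicAt

section TransferOp

variable {H : Type*} [NormedAddCommGroup H] [InnerProductSpace ℂ H]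
  {T : H →ₗ.[ℂ] H} {z₀ : ℂ}

theorem analyticAt_transferOp_left [CompleteSpace H] (hz : z₀ ∈ resSet T) (w : ℂ) :
    AnalyticAt ℂ (fun z => transferOp T z w) z₀ := by
  have hR := analyticAt_resolventOp hz
  unfold transferOp
  fun_prop

theorem analyticAt_transferOp_right (w : ℂ) : AnalyticAt ℂ (transferOp T w) z₀ := by
  unfold transferOp
  fun_prop

theorem FinMero.transferOp_left (hR : FinMero z₀ (resolventOp T)) (w : ℂ) :
    FinMero z₀ fun z => transferOp T z w :=
  .add (.analytic analyticAt_const) (hR.smul (c := fun z => z - w) (by fun_prop))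

end TransferOp

namespace BoundaryTriple

variable {H : Type*} [NormedAddCommGroup H] [InnerProductSpace ℂ H] [CompleteSpace H]
  {S : H →ₗ.[ℂ] H} {G : Type*} [NormedAddCommGroup G] [InnerProductSpace ℂ G]
  {b : BoundaryTriple S G} {Θ : G →ₗ.[ℂ] G} {z z₀ w : ℂ} {r : ℝ}

section Analytic

theorem analyticAt_weylInv (P : H →L[ℂ] G) (Q : G →L[ℂ] H) (hz : z ∈ resSet b.kerExtension)
    (hzΘ : z ∈ resSet (b.extension Θ)) : AnalyticAt ℂ (b.weylInv Θ w P Q) z := by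
  have hU : AnalyticAt ℂ (transferOp b.kerExtension w) z := analyticAt_transferOp_right w
  exact analyticAt_clm_comp (analyticAt_clm_comp analyticAt_const hU)
    (analyticAt_clm_comp ((analyticAt_resolventOp hzΘ).sub (analyticAt_resolventOp hz))
      (analyticAt_clm_comp hU analyticAt_const))

theorem finMero_weylInv (P : H →L[ℂ] G) (Q : G →L[ℂ] H)
    (hR : FinMero z₀ (resolventOp b.kerExtension))
    (hRΘ : FinMero z₀ (resolventOp (b.extension Θ))) : FinMero z₀ (b.weylInv Θ w P Q) := by
  have hU : FinMero z₀ (transferOp b.kerExtension w) := .analytic (analyticAt_transferOp_right w)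
  exact .comp (.comp (.analytic analyticAt_const) hU)
    (.comp (hRΘ.sub hR) (.comp hU (.analytic analyticAt_const)))

variable [CompleteSpace G]

theorem analyticAt_gammaCLM (hA : IsSelfAdjoint b.kerExtension)
    (hz : z ∈ resSet b.kerExtension) : AnalyticAt ℂ b.gammaCLM z := by
  refine (analyticAt_clm_comp (analyticAt_transferOp_left hz z)
    (analyticAt_const (v := b.gammaCLM z))).congr ?_
  filter_upwards [isOpen_resSet.mem_nhds hz] with x hx using (gammaCLM_eq_comp hA hx hz).symm

theorem analyticAt_gammaAdjoint (hA : IsSelfAdjoint b.kerExtension)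
    (hz : z ∈ resSet b.kerExtension) : AnalyticAt ℂ b.gammaAdjoint z := by
  refine (analyticAt_clm_comp (analyticAt_const (v := b.gammaAdjoint z))
    (analyticAt_transferOp_left hz z)).congr ?_
  filter_upwards [isOpen_resSet.mem_nhds hz] with x hx using (gammaAdjoint_eq_comp hA hx hz).symm

theorem finMero_gammaCLM (hA : IsSelfAdjoint b.kerExtension)
    (hdA : IsIsolatingDisc b.kerExtension z₀ r) : FinMero z₀ b.gammaCLM := by
  obtain ⟨w, hw⟩ := hdA.eventually_mem_resSet.exists
  refine .congr (.comp (hdA.finMero_resolventOp.transferOp_left w)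
    (.analytic (analyticAt_const (v := b.gammaCLM w)))) ?_
  filter_upwards [hdA.eventually_mem_resSet] with x hx using (gammaCLM_eq_comp hA hx hw).symm

theorem finMero_gammaAdjoint (hA : IsSelfAdjoint b.kerExtension)
    (hdA : IsIsolatingDisc b.kerExtension z₀ r) : FinMero z₀ b.gammaAdjoint := by
  obtain ⟨w, hw⟩ := hdA.eventually_mem_resSet.exists
  refine .congr (.comp (.analytic (analyticAt_const (v := b.gammaAdjoint w)))
    (hdA.finMero_resolventOp.transferOp_left w)) ?_
  filter_upwards [hdA.eventually_mem_resSet] with x hx using (gammaAdjoint_eq_comp hA hx hw).symm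

theorem hasDerivAt_weylCLM (hA : IsSelfAdjoint b.kerExtension)
    (hz : z ∈ resSet b.kerExtension) :
    HasDerivAt b.weylCLM (b.gammaAdjoint z ∘L b.gammaCLM z) z := by
  have hγ : AnalyticAt ℂ (fun x => b.gammaAdjoint z ∘L b.gammaCLM x) z :=
    analyticAt_clm_comp analyticAt_const (analyticAt_gammaCLM hA hz)
  have hlin : HasDerivAt (fun x => b.weylCLM z + (x - z) • (b.gammaAdjoint z ∘L b.gammaCLM x))
      (b.gammaAdjoint z ∘L b.gammaCLM z) z := by
    simpa using (((hasDerivAt_id z).sub_const z).smul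
      hγ.differentiableAt.hasDerivAt).const_add (b.weylCLM z)
  refine hlin.congr_of_eventuallyEq ?_
  filter_upwards [isOpen_resSet.mem_nhds hz] with x hx
  rw [← weylCLM_sub hA hz hx, add_sub_cancel]

theorem analyticAt_weylCLM (hA : IsSelfAdjoint b.kerExtension)
    (hz : z ∈ resSet b.kerExtension) : AnalyticAt ℂ b.weylCLM z :=
  DifferentiableOn.analyticAt (fun _ hx =>
    (hasDerivAt_weylCLM hA hx).differentiableAt.differentiableWithinAt)
    (isOpen_resSet.mem_nhds hz)

end Analytic

section IndexHypothesis

variable [CompleteSpace G]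

theorem value_weylDiff (hA : IsSelfAdjoint b.kerExtension) (hz : z ∈ resSet b.kerExtension)
    (φ : Θ.domain) : value (b.weylDiff Θ z) φ = Θ φ - b.weylCLM z φ := by
  rw [weylCLM_apply hA hz]
  exact dif_pos φ.2

theorem isDerivExtension_weylDiff (hA : IsSelfAdjoint b.kerExtension)
    (hz : z ∈ resSet b.kerExtension) :
    IsDerivExtension (b.weylDiff Θ) z (-(b.gammaAdjoint z ∘L b.gammaCLM z)) := by
  intro φ hφ
  have hderiv : HasDerivAt (fun x => Θ ⟨φ, hφ⟩ - b.weylCLM x φ)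
      (-((b.gammaAdjoint z ∘L b.gammaCLM z) φ)) z := by
    simpa using ((hasDerivAt_weylCLM hA hz).clm_apply
      (hasDerivAt_const z φ)).const_sub (Θ ⟨φ, hφ⟩)
  refine (hderiv.congr_of_eventuallyEq ?_).deriv.symm
  filter_upwards [isOpen_resSet.mem_nhds hz] with x hx using
    value_weylDiff (Θ := Θ) hA hx ⟨φ, hφ⟩

theorem derivClosure_weylDiff (hA : IsSelfAdjoint b.kerExtension)
    (hΘ : Dense (Θ.domain : Set G)) (hz : z ∈ resSet b.kerExtension) :
    derivClosure (b.weylDiff Θ) z = -(b.gammaAdjoint z ∘L b.gammaCLM z) := by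
  have h := isDerivExtension_weylDiff (Θ := Θ) hA hz
  have hex : ∃ K, IsDerivExtension (b.weylDiff Θ) z K := ⟨_, h⟩
  rw [derivClosure, dif_pos hex]
  refine DFunLike.coe_injective (Continuous.ext_on hΘ (map_continuous _) (map_continuous _) ?_)
  exact fun φ hφ => (hex.choose_spec φ hφ).trans (h φ hφ).symm

variable {U : Set ℂ}

theorem analyticOnNhd_boundedInverse_weylDiff (hA : IsSelfAdjoint b.kerExtension)
    (hU : IsOpen U) (hUA : U ⊆ resSet b.kerExtension) (hUΘ : U ⊆ resSet (b.extension Θ)) :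
    AnalyticOnNhd ℂ (fun z => boundedInverse (b.weylDiff Θ z)) U := by
  intro z hz
  obtain ⟨P, hP⟩ := hasLeftInverse_gammaCLM hA (hUA hz)
  obtain ⟨Q, hQ⟩ := hasRightInverse_gammaAdjoint hA (hUA hz)
  refine (analyticAt_weylInv (w := z) P Q (hUA hz) (hUΘ hz)).congr ?_
  filter_upwards [hU.mem_nhds hz] with x hx
  exact (isBoundedInverse_weylInv hA (hUA hz) hP hQ (hUA hx) (hUΘ hx)).boundedInverse_eq.symm

theorem analyticOnNhd_derivClosure_weylDiff (hA : IsSelfAdjoint b.kerExtension)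
    (hΘ : Dense (Θ.domain : Set G)) (hU : IsOpen U) (hUA : U ⊆ resSet b.kerExtension) :
    AnalyticOnNhd ℂ (derivClosure (b.weylDiff Θ)) U := by
  intro z hz
  refine (analyticAt_clm_comp (analyticAt_gammaAdjoint hA (hUA hz))
    (analyticAt_gammaCLM hA (hUA hz))).neg.congr ?_
  filter_upwards [hU.mem_nhds hz] with x hx using (derivClosure_weylDiff hA hΘ (hUA hx)).symm

theorem finMero_boundedInverse_weylDiff (hA : IsSelfAdjoint b.kerExtension)
    (hdA : IsIsolatingDisc b.kerExtension z₀ r)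
    (hdΘ : IsIsolatingDisc (b.extension Θ) z₀ r) :
    FinMero z₀ fun z => boundedInverse (b.weylDiff Θ z) := by
  obtain ⟨w, hw⟩ := hdA.eventually_mem_resSet.exists
  obtain ⟨P, hP⟩ := hasLeftInverse_gammaCLM hA hw
  obtain ⟨Q, hQ⟩ := hasRightInverse_gammaAdjoint hA hw
  refine .congr (finMero_weylInv (w := w) P Q hdA.finMero_resolventOp hdΘ.finMero_resolventOp) ?_
  filter_upwards [hdA.eventually_mem_resSet, hdΘ.eventually_mem_resSet] with x hx hxΘ
  exact (isBoundedInverse_weylInv hA hw hP hQ hx hxΘ).boundedInverse_eq.symm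

theorem finMero_derivClosure_weylDiff (hA : IsSelfAdjoint b.kerExtension)
    (hΘ : Dense (Θ.domain : Set G)) (hdA : IsIsolatingDisc b.kerExtension z₀ r) :
    FinMero z₀ (derivClosure (b.weylDiff Θ)) := by
  refine .congr ((finMero_gammaAdjoint hA hdA).comp (finMero_gammaCLM hA hdA)).neg ?_
  filter_upwards [hdA.eventually_mem_resSet] with x hx using
    (derivClosure_weylDiff hA hΘ hx).symm

theorem analyticOnNhd_value_weylDiff (hA : IsSelfAdjoint b.kerExtension) (hU : IsOpen U)
    (hUA : U ⊆ resSet b.kerExtension) (φ : Θ.domain) :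
    AnalyticOnNhd ℂ (fun z => value (b.weylDiff Θ z) φ) U := by
  intro z hz
  have hM : AnalyticAt ℂ (fun x => b.weylCLM x φ) z :=
    ((ContinuousLinearMap.apply ℂ G (φ : G)).analyticAt _).comp (analyticAt_weylCLM hA (hUA hz))
  refine ((analyticAt_const (v := Θ φ)).sub hM).congr ?_
  filter_upwards [hU.mem_nhds hz] with x hx using (value_weylDiff hA (hUA hx) φ).symm

theorem indexHypothesis_weylDiff (hA : IsSelfAdjoint b.kerExtension)
    (hΘ : Dense (Θ.domain : Set G)) (hdA : IsIsolatingDisc b.kerExtension z₀ r)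
    (hdΘ : IsIsolatingDisc (b.extension Θ) z₀ r) :
    IndexHypothesis (b.weylDiff Θ) (ball z₀ r) {z₀} := by
  have hopen : IsOpen (ball z₀ r \ {z₀}) := isOpen_ball.sdiff isClosed_singleton
  have hinv := analyticOnNhd_boundedInverse_weylDiff hA hopen hdA.subset_resSet hdΘ.subset_resSet
  have hderiv := analyticOnNhd_derivClosure_weylDiff hA hΘ hopen hdA.subset_resSet
  have hbdd : ∀ z ∈ ball z₀ r \ {z₀}, BoundedlyInvertible (b.weylDiff Θ z) := fun z hz =>
    boundedlyInvertible_weylDiff hA (hdA.subset_resSet hz) (hdΘ.subset_resSet hz)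
  exact {
    isOpen := isOpen_ball
    isConnected := (convex_ball z₀ r).isConnected (nonempty_ball.mpr hdA.pos)
    subset := Set.singleton_subset_iff.mpr (mem_ball_self hdA.pos)
    discrete := fun _ _ hacc => Set.Infinite.of_accPt hacc (Set.finite_singleton z₀)
    dense := fun _ _ => hΘ
    closed := fun z hz => (hbdd z hz).isClosed
    domain_eq := fun _ _ _ _ => rfl
    invertible := hbdd
    inverse_analytic := hinv
    inverse_finMero :=
      finitelyMeromorphicOn_ball (finMero_boundedInverse_weylDiff hA hdA hdΘ) hinv
    strongly_analytic := fun φ hφ z hz =>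
      analyticOnNhd_value_weylDiff (Θ := Θ) hA hopen hdA.subset_resSet ⟨φ, hφ z hz⟩ z hz
    deriv_bounded := fun _ hz => ⟨_, isDerivExtension_weylDiff hA (hdA.subset_resSet hz)⟩
    deriv_analytic := hderiv
    deriv_finMero := finitelyMeromorphicOn_ball (finMero_derivClosure_weylDiff hA hΘ hdA) hderiv }

end IndexHypothesis

section Index

variable [CompleteSpace G] {δ ε : ℝ}

theorem indexOperator_weylDiff (hA : IsSelfAdjoint b.kerExtension)
    (hΘ : Dense (Θ.domain : Set G)) (hdA : IsIsolatingDisc b.kerExtension z₀ r)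
    (hdΘ : IsIsolatingDisc (b.extension Θ) z₀ r) (hδ : 0 < δ) (hδε : δ ≤ ε) (hεr : ε < r) :
    indexOperator (b.weylDiff Θ) z₀ ε =
      -(2 * Real.pi * Complex.I : ℂ)⁻¹ • ∮ ζ in C(z₀, δ),
        b.gammaAdjoint ζ ∘L (b.gammaCLM ζ ∘L boundedInverse (b.weylDiff Θ ζ)) := by
  have hindex := indexHypothesis_weylDiff hA hΘ hdA hdΘ
  have hball : closedBall z₀ ε \ {z₀} ⊆ ball z₀ r \ {z₀} :=
    Set.sdiff_subset_sdiff_left (closedBall_subset_ball hεr)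
  have hneg : (∮ ζ in C(z₀, δ), derivClosure (b.weylDiff Θ) ζ ∘L
        boundedInverse (b.weylDiff Θ ζ)) =
      ∮ ζ in C(z₀, δ),
        (-1 : ℂ) • b.gammaAdjoint ζ ∘L (b.gammaCLM ζ ∘L boundedInverse (b.weylDiff Θ ζ)) := by
    refine circleIntegral.integral_congr hδ.le fun ζ hζ => ?_
    have hζA := hdA.closedBall_diff_subset (hδε.trans_lt hεr)
      (sphere_subset_closedBall_diff hδ hζ)
    rw [derivClosure_weylDiff hA hΘ hζA, neg_one_smul, ContinuousLinearMap.neg_comp,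
      ContinuousLinearMap.comp_assoc]
  rw [indexOperator, circleIntegral_eq_of_analyticAt_punctured (fun z hz => analyticAt_clm_comp
    (hindex.deriv_analytic z (hball hz)) (hindex.inverse_analytic z (hball hz))) hδ hδε, hneg,
    circleIntegral.integral_smul, smul_smul, mul_neg_one]

theorem rieszProjection_extension_sub (hA : IsSelfAdjoint b.kerExtension)
    (hdA : IsIsolatingDisc b.kerExtension z₀ r) (hdΘ : IsIsolatingDisc (b.extension Θ) z₀ r)
    (hδ : δ ∈ Set.Ioo 0 r) :
    rieszProjection (b.extension Θ) z₀ δ - rieszProjection b.kerExtension z₀ δ =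
      -(2 * Real.pi * Complex.I : ℂ)⁻¹ • ∮ ζ in C(z₀, δ),
        (b.gammaCLM ζ ∘L boundedInverse (b.weylDiff Θ ζ)) ∘L b.gammaAdjoint ζ := by
  have hρA := hdA.closedBall_diff_subset hδ.2
  have hρΘ := hdΘ.closedBall_diff_subset hδ.2
  have hkrein : (∮ ζ in C(z₀, δ), resolventOp (b.extension Θ) ζ - resolventOp b.kerExtension ζ) =
      ∮ ζ in C(z₀, δ),
        (b.gammaCLM ζ ∘L boundedInverse (b.weylDiff Θ ζ)) ∘L b.gammaAdjoint ζ :=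
    circleIntegral.integral_congr hδ.1.le fun ζ hζ =>
      have hζ' := sphere_subset_closedBall_diff hδ.1 hζ
      krein_formula hA (hρA hζ') (hρΘ hζ')
  rw [← hkrein, circleIntegral.integral_sub (circleIntegrable_resolventOp hδ.1 hρΘ)
    (circleIntegrable_resolventOp hδ.1 hρA), rieszProjection, rieszProjection]
  module

theorem generalizedIndex_weylDiff (hA : IsSelfAdjoint b.kerExtension)
    (hΘ : Dense (Θ.domain : Set G)) (hdA : IsIsolatingDisc b.kerExtension z₀ r)
    (hdΘ : IsIsolatingDisc (b.extension Θ) z₀ r) (hε : 0 < ε) (hεr : ε < r) :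
    FiniteRank (indexOperator (b.weylDiff Θ) z₀ ε) ∧
      generalizedIndex (b.weylDiff Θ) z₀ ε =
        (algMult (b.extension Θ) z₀ : ℂ) - (algMult b.kerExtension z₀ : ℂ) := by
  obtain ⟨δ, htrace, hδ, hδε⟩ := ((finMero_gammaAdjoint hA hdA).traceSymm
    ((finMero_gammaCLM hA hdA).comp (finMero_boundedInverse_weylDiff hA hdA hdΘ))
    |>.and (Ioo_mem_nhdsGT hε)).exists
  have hδr : δ ∈ Set.Ioo 0 r := ⟨hδ, hδε.trans hεr⟩
  rw [generalizedIndex, indexOperator_weylDiff hA hΘ hdA hdΘ hδ hδε.le hεr]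
  refine ⟨finiteRank_iff.mpr ((finiteRank_iff.mp htrace.finiteRank).smul _), ?_⟩
  rw [finiteRankTrace_smul htrace.finiteRank, htrace.trace_eq,
    ← finiteRankTrace_smul htrace.finiteRank_swap, ← rieszProjection_extension_sub hA hdA hdΘ hδr,
    finiteRankTrace_sub (hdΘ.finiteRank δ hδr) (hdA.finiteRank δ hδr),
    hdΘ.finiteRankTrace_eq_algMult hδr, hdA.finiteRankTrace_eq_algMult hδr]

end Index

end BoundaryTriple

end ExtIndex

theorem theorem4p3_general
    {H : Type*} [NormedAddCommGroup H] [InnerProductSpace ℂ H] [CompleteSpace H]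
    {G : Type*} [NormedAddCommGroup G] [InnerProductSpace ℂ G] [CompleteSpace G]
    {S : H →ₗ.[ℂ] H} (hS : Dense (S.domain : Set H)) (hsymm : S.IsFormalAdjoint S)
    (b : BoundaryTriple S G) {Θ₁ Θ₂ : G →ₗ.[ℂ] G}
    (hΘ₁ : Dense (Θ₁.domain : Set G)) (hΘ₂ : Dense (Θ₂.domain : Set G)) {z₀ : ℂ}
    (hz₁ : z₀ ∈ discreteSpectrum (b.extension Θ₁) ∪ resSet (b.extension Θ₁))
    (hz₂ : z₀ ∈ discreteSpectrum (b.extension Θ₂) ∪ resSet (b.extension Θ₂))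
    (hz₀ : z₀ ∈ discreteSpectrum b.kerExtension ∪ resSet b.kerExtension) :
    ∃ ε₀ > 0,
      IndexHypothesis (b.weylDiff Θ₁) (Metric.ball z₀ ε₀) {z₀} ∧
      IndexHypothesis (b.weylDiff Θ₂) (Metric.ball z₀ ε₀) {z₀} ∧
      ∀ ε, 0 < ε → ε < ε₀ →
        FiniteRank (indexOperator (b.weylDiff Θ₁) z₀ ε) ∧
        FiniteRank (indexOperator (b.weylDiff Θ₂) z₀ ε) ∧
        generalizedIndex (b.weylDiff Θ₁) z₀ ε - generalizedIndex (b.weylDiff Θ₂) z₀ ε =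
          (algMult (b.extension Θ₁) z₀ : ℂ) - (algMult (b.extension Θ₂) z₀ : ℂ) := by
  have hA := b.isSelfAdjoint_kerExtension hS hsymm
  obtain ⟨ε₀, hd₀, hd₁, hd₂⟩ := ((eventually_isIsolatingDisc hz₀).and
    ((eventually_isIsolatingDisc hz₁).and (eventually_isIsolatingDisc hz₂))).exists
  refine ⟨ε₀, hd₀.pos, b.indexHypothesis_weylDiff hA hΘ₁ hd₀ hd₁,
    b.indexHypothesis_weylDiff hA hΘ₂ hd₀ hd₂, fun ε hε hεε₀ => ?_⟩
  obtain ⟨hfin₁, hind₁⟩ := b.generalizedIndex_weylDiff hA hΘ₁ hd₀ hd₁ hε hεε₀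
  obtain ⟨hfin₂, hind₂⟩ := b.generalizedIndex_weylDiff hA hΘ₂ hd₀ hd₂ hε hεε₀
  refine ⟨hfin₁, hfin₂, ?_⟩
  rw [hind₁, hind₂, sub_sub_sub_cancel_right]

theorem theorem4p3
    {H : Type*} [NormedAddCommGroup H] [InnerProductSpace ℂ H] [CompleteSpace H]
    {G : Type*} [NormedAddCommGroup G] [InnerProductSpace ℂ G] [CompleteSpace G]
    (B₁ B₂ S A₀ : H →ₗ.[ℂ] H) (hyp : ExtensionHypothesis B₁ B₂ S A₀)
    (b : BoundaryTriple S G) (hA₀ : A₀ = b.kerExtension)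
    (Θ₁ Θ₂ : G →ₗ.[ℂ] G)
    (hΘ₁dense : Dense (Θ₁.domain : Set G)) (hΘ₁closed : Θ₁.IsClosed)
    (hΘ₂dense : Dense (Θ₂.domain : Set G)) (hΘ₂closed : Θ₂.IsClosed)
    (hB₁ : B₁ = b.extension Θ₁) (hB₂ : B₂ = b.extension Θ₂)
    (z₀ : ℂ)
    (hz₁ : z₀ ∈ discreteSpectrum B₁ ∪ resSet B₁)
    (hz₂ : z₀ ∈ discreteSpectrum B₂ ∪ resSet B₂)
    (hz₀ : z₀ ∈ discreteSpectrum A₀ ∪ resSet A₀) :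
    ∃ ε₀ > 0,
      IndexHypothesis (fun z => subMap Θ₁ (b.weyl z)) (Metric.ball z₀ ε₀) {z₀} ∧
      IndexHypothesis (fun z => subMap Θ₂ (b.weyl z)) (Metric.ball z₀ ε₀) {z₀} ∧
      ∀ ε, 0 < ε → ε < ε₀ →
        FiniteRank (indexOperator (fun z => subMap Θ₁ (b.weyl z)) z₀ ε) ∧
        FiniteRank (indexOperator (fun z => subMap Θ₂ (b.weyl z)) z₀ ε) ∧
        generalizedIndex (fun z => subMap Θ₁ (b.weyl z)) z₀ ε -
            generalizedIndex (fun z => subMap Θ₂ (b.weyl z)) z₀ ε =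
          (algMult B₁ z₀ : ℂ) - (algMult B₂ z₀ : ℂ) := by
  subst hA₀ hB₁ hB₂
  exact theorem4p3_general hyp.dense hyp.symmetric b hΘ₁dense hΘ₂dense hz₁ hz₂ hz₀
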